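/- \textbf{Theorem (Solovay--Kitaev).} Let $d$ be a natural number and let $\mathcal G\subset SU(d)$ be an instruction set, i.e. a finite set of gates such that $g^{-1}\in\mathcal G$ for all $g\in\mathcal G$ and such that the group generated by $\mathcal G$ is dense in $SU(d)$. For $U,S\in SU(d)$ let $d(U,S)=\|U-S\|$, where $\|\cdot\|$ is the operator norm induced by the Euclidean norm on $\mathbb C^d$. For $\epsilon>0$ put $\Lambda(\epsilon)=\max\{1,\ln(1/\epsilon)\}$. (1) There is a constant $K$, depending only on $d$ and $\mathcal G$, such that for every $\epsilon>0$ and every $U\in SU(d)$ there is a finite sequence $g_1,\dots,g_m$ of gates from $\mathcal G$ with $$d(U,g_1g_2\cdots g_m)<\epsilon\qquad\text{and}\qquad m\le K\,\Lambda(\epsilon)^{\ln 5/\ln(3/2)},\qquad \frac{\ln 5}{\ln(3/2)}\approx 3.97 .$$ (2) Such sequences can be found by an algorithm: there are a program $P$ and a constant $K$, depending only on $d$ and $\mathcal G$, such that for every $\epsilon>0$ and every $U\in SU(d)$ the program $P$, on the input $(U,\epsilon)$, halts after at most $$K\,\Lambda(\epsilon)^{\ln 3/\ln(3/2)},\qquad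 \frac{\ln 3}{\ln(3/2)}\approx 2.71,$$ steps and outputs, in compressed form, a sequence $g_1,\dots,g_m$ of gates from $\mathcal G$ with $d(U,g_1g_2\cdots g_m)<\epsilon$ and $m\le K\,\Lambda(\epsilon)^{\ln 5/\ln(3/2)}$. Here a program is a finite text with finitely many, possibly recursive, procedures. It computes exactly with real numbers: real constants, $+,-,\times,/,\sqrt{\ }$ and comparisons have unit cost, as has each argument or result passed in a procedure call. Its input is $\epsilon$ and the real and imaginary parts of the entries of $U$. The output sequence is given by pointers: in one step the program can store one memory cell, which denotes the empty sequence, a single gate, or (by two pointers to cells stored earlier) the concatenation of two sequences stored earlier; the output is a pointer to a cell. -/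

import Mathlib

noncomputable section

namespace SolovayKitaev

/-! ### Quantum gates, instruction sets and approximation -/

/-- The special unitary group `SU(d)`. -/
abbrev SU (d : ℕ) : Type := Matrix.specialUnitaryGroup (Fin d) ℂ

/-- An instruction set: a finite set of gates in `SU(d)` that is closed under inverses and
generates a dense subgroup of `SU(d)`. -/
structure IsInstructionSet {d : ℕ} (G : Finset (SU d)) : Prop where
  inv_mem : ∀ g ∈ G, g⁻¹ ∈ G
  dense : Dense ((Subgroup.closure (G : Set (SU d)) : Subgroup (SU d)) : Set (SU d))

/-- The distance `d(U, S) = ‖U - S‖`, for the operator norm induced by the Euclidean norm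
of `ℂ^d`. -/
def opDist {d : ℕ} (U S : SU d) : ℝ :=
  ‖Matrix.toEuclideanCLM (n := Fin d) (𝕜 := ℂ)
    ((U : Matrix (Fin d) (Fin d) ℂ) - (S : Matrix (Fin d) (Fin d) ℂ))‖

/-- The finite sequence `w = [g₁, …, g_m]` consists of gates from `G`, and its product
`g₁ ⋯ g_m` is an `ε`-approximation to `U`. -/
def IsApproximation {d : ℕ} (G : Finset (SU d)) (U : SU d) (ε : ℝ) (w : List (SU d)) : Prop :=
  (∀ g ∈ w, g ∈ G) ∧ opDist U w.prod < ε

/-! ### Compressed sequences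

A sequence is output as a store of cells.  A cell is the empty sequence, a single letter,
or a pair of pointers to two cells that were stored earlier; the last stands for the
concatenation of the two sequences pointed to. -/

/-- A memory cell of a compressed sequence with letters in `Γ`. -/
inductive Cell (Γ : Type) : Type
  | empty : Cell Γ
  | letter (g : Γ) : Cell Γ
  | concat (p q : ℕ) : Cell Γ

/-- The sequence denoted by a cell, given the list of the sequences that are denoted by the cells
at the addresses `0, 1, 2, …` stored before it. -/
def Cell.word {Γ : Type} (ws : List (List Γ)) : Cell Γ → List Γ
  | .empty => []
  | .letter g => [g]
  | .concat p q => ws.getD p [] ++ ws.getD q []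

/-- The sequences denoted by the cells of a store, in the order of their addresses. -/
def storeWords {Γ : Type} (h : List (Cell Γ)) : List (List Γ) :=
  h.foldl (fun ws c => ws ++ [c.word ws]) []

/-- The sequence denoted by the cell at address `p` of the store `h`. -/
def storeWord {Γ : Type} (h : List (Cell Γ)) (p : ℕ) : List Γ :=
  (storeWords h).getD p []

/-! ### Real-number programs with recursive procedures and a step count

The machine model is a real RAM: exact real arithmetic, square roots and comparisons of real
numbers at unit cost.  Programs are finite texts which may contain real constants.  They act on
registers that hold real numbers, registers that hold pointers (addresses of cells), and a store to
which cells can only be appended, one per step.  Procedures may be recursive, and each call has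
registers of its own. -/

/-- Arithmetical expressions in the real registers `0, 1, 2, …`. -/
inductive RExpr : Type
  | const (c : ℝ) : RExpr
  | reg (x : ℕ) : RExpr
  | add (a b : RExpr) : RExpr
  | sub (a b : RExpr) : RExpr
  | mul (a b : RExpr) : RExpr
  | div (a b : RExpr) : RExpr
  | sqrt (a : RExpr) : RExpr

/-- The value of an expression; operations outside of their domain (division by `0`, square
root of a negative number) return `0`. -/
def RExpr.eval (r : ℕ → ℝ) : RExpr → ℝ
  | .const c => c
  | .reg x => r x
  | .add a b => a.eval r + b.eval r
  | .sub a b => a.eval r - b.eval r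
  | .mul a b => a.eval r * b.eval r
  | .div a b => a.eval r / b.eval r
  | .sqrt a => Real.sqrt (a.eval r)

/-- The number of steps needed to evaluate an expression: one for each constant, each access to
a register and each operation. -/
def RExpr.cost : RExpr → ℕ
  | .const _ => 1
  | .reg _ => 1
  | .add a b => a.cost + b.cost + 1
  | .sub a b => a.cost + b.cost + 1
  | .mul a b => a.cost + b.cost + 1
  | .div a b => a.cost + b.cost + 1
  | .sqrt a => a.cost + 1

/-- Commands.  `assign` writes to a real register and `move` copies a pointer register.  The
commands `newEmpty`, `newLetter`, `newConcat` append one cell to the store and put its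
address in the pointer register `x`.  `ifLE a b c c'` runs `c` if `a ≤ b` and `c'` otherwise.
`call f args pargs x m y l` runs procedure `f` on the values of the `k` expressions `args` and of
the `j` pointer registers `pargs`, and returns `m` real numbers to the real registers `x, …, x+m-1`
and `l` pointers to the pointer registers `y, …, y+l-1`. -/
inductive Cmd (Γ : Type) : Type
  | skip : Cmd Γ
  | assign (x : ℕ) (e : RExpr) : Cmd Γ
  | move (x y : ℕ) : Cmd Γ
  | newEmpty (x : ℕ) : Cmd Γ
  | newLetter (x : ℕ) (g : Γ) : Cmd Γ
  | newConcat (x y z : ℕ) : Cmd Γ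
  | seq (c c' : Cmd Γ) : Cmd Γ
  | ifLE (a b : RExpr) (c c' : Cmd Γ) : Cmd Γ
  | call (f : ℕ) {k j : ℕ} (args : Fin k → RExpr) (pargs : Fin j → ℕ) (x m y l : ℕ) : Cmd Γ

/-- A program: a main command and finitely many procedures, which are called by their number. -/
structure Program (Γ : Type) : Type where
  main : Cmd Γ
  procs : List (Cmd Γ)

/-- A state: the contents of the real registers, of the pointer registers, and of the store. -/
structure State (Γ : Type) : Type where
  reg : ℕ → ℝ
  ptr : ℕ → ℕ
  store : List (Cell Γ)

/-- Append the cell `c` to the store and put its address in the pointer register `x`. -/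
def State.alloc {Γ : Type} (s : State Γ) (x : ℕ) (c : Cell Γ) : State Γ :=
  { reg := s.reg
    ptr := Function.update s.ptr x s.store.length
    store := s.store ++ [c] }

/-- The registers at the start of a call: the arguments are in the registers `0, …, k-1`, and the
other registers hold `0`. -/
def loadArgs {α : Type} [Zero α] {k : ℕ} (v : Fin k → α) (i : ℕ) : α :=
  if h : i < k then v ⟨i, h⟩ else 0

/-- The caller's registers `r` after a call has returned the first `m` registers of `r'` to the
registers `x, …, x+m-1`. -/
def storeResults {α : Type} (r r' : ℕ → α) (x m : ℕ) (i : ℕ) : α :=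
  if x ≤ i ∧ i < x + m then r' (i - x) else r i

/-- `Exec P c s t s'`: in the program `P`, the command `c`, started in the state `s`, halts after
`t` steps in the state `s'`. -/
inductive Exec {Γ : Type} (P : Program Γ) : Cmd Γ → State Γ → ℕ → State Γ → Prop
  | skip (s : State Γ) : Exec P .skip s 1 s
  | assign (x : ℕ) (e : RExpr) (s : State Γ) :
      Exec P (.assign x e) s (e.cost + 1)
        { s with reg := Function.update s.reg x (e.eval s.reg) }
  | move (x y : ℕ) (s : State Γ) :
      Exec P (.move x y) s 1 { s with ptr := Function.update s.ptr x (s.ptr y) }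
  | newEmpty (x : ℕ) (s : State Γ) : Exec P (.newEmpty x) s 1 (s.alloc x .empty)
  | newLetter (x : ℕ) (g : Γ) (s : State Γ) :
      Exec P (.newLetter x g) s 1 (s.alloc x (.letter g))
  | newConcat (x y z : ℕ) (s : State Γ) :
      Exec P (.newConcat x y z) s 1 (s.alloc x (.concat (s.ptr y) (s.ptr z)))
  | seq {c c' : Cmd Γ} {s s' s'' : State Γ} {t t' : ℕ} :
      Exec P c s t s' → Exec P c' s' t' s'' → Exec P (.seq c c') s (t + t') s''
  | ifTrue {a b : RExpr} {c c' : Cmd Γ} {s s' : State Γ} {t : ℕ} :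
      a.eval s.reg ≤ b.eval s.reg → Exec P c s t s' →
        Exec P (.ifLE a b c c') s (a.cost + b.cost + 1 + t) s'
  | ifFalse {a b : RExpr} {c c' : Cmd Γ} {s s' : State Γ} {t : ℕ} :
      b.eval s.reg < a.eval s.reg → Exec P c' s t s' →
        Exec P (.ifLE a b c c') s (a.cost + b.cost + 1 + t) s'
  | call {f k j x m y l : ℕ} {args : Fin k → RExpr} {pargs : Fin j → ℕ} {body : Cmd Γ}
      {s s' : State Γ} {t : ℕ} :
      P.procs[f]? = some body →
      Exec P body
        { reg := loadArgs fun i => (args i).eval s.reg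
          ptr := loadArgs fun i => s.ptr (pargs i)
          store := s.store } t s' →
      Exec P (.call f args pargs x m y l) s (((∑ i, (args i).cost) + j + m + l + 1) + t)
        { reg := storeResults s.reg s'.reg x m
          ptr := storeResults s.ptr s'.ptr y l
          store := s'.store }

/-- The input registers: for `i, j < d`, register `d * i + j` holds the real part and register
`d * d + (d * i + j)` the imaginary part of the entry `U i j`; register `2 * d * d` holds `ε`. -/
def inputReg {d : ℕ} (U : SU d) (ε : ℝ) (k : ℕ) : ℝ :=
  if h : k < d * d then
    ((U : Matrix (Fin d) (Fin d) ℂ) (Fin.divNat ⟨k, h⟩) (Fin.modNat ⟨k, h⟩)).re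
  else if h : k - d * d < d * d then
    ((U : Matrix (Fin d) (Fin d) ℂ) (Fin.divNat ⟨k - d * d, h⟩) (Fin.modNat ⟨k - d * d, h⟩)).im
  else if k = 2 * d * d then ε
  else 0

/-- On the input `(U, ε)`, the program `P` halts after `t` steps, and at that moment pointer
register `0` points to a cell that denotes the sequence `w`. -/
def Program.Outputs {d : ℕ} (P : Program (SU d)) (U : SU d) (ε : ℝ) (t : ℕ) (w : List (SU d)) :
    Prop :=
  ∃ s : State (SU d),
    Exec P P.main { reg := inputReg U ε, ptr := fun _ => 0, store := [] } t s ∧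
      s.ptr 0 < s.store.length ∧ storeWord s.store (s.ptr 0) = w

end SolovayKitaev

end

/-!
The Solovay-Kitaev theorem rests on one fact about `SU(d)`: an element `Δ` at distance `σ²` from
the identity is, up to an error of order `σ³`, a group commutator `V W V⁻¹ W⁻¹` with `V` and `W`
at distance of order `σ` from the identity (`exists_balanced_commutator`). If `V` and `W` are
replaced by approximations with error `σ²`, the commutator changes by `O(σ³)` only, because in
`V W V⁻¹ W⁻¹ - 1 = [V - 1, W - 1] V⁻¹ W⁻¹` each error is multiplied by a quantity of order `σ`. So
an approximation `u` of `U` with error `σ²` is improved to `v w v⁻¹ w⁻¹ u` with error `O(σ³)`,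
where `v` and `w` approximate the factors of the commutator for `Δ = U u⁻¹`
(`exists_refinement_const`). One level of this recursion raises the error to the power `3/2`,
multiplies the length of the words by `5` and, with inverses kept alongside the words and words
shared by means of pointers, the number of steps by `3`, up to a constant. The required number `N`
of levels satisfies `(3/2)^N = O(Λ)` with `Λ = max 1 (log (1 / ε))`, whence the exponents
`log 5 / log (3/2)` and `log 3 / log (3/2)` of `Λ`. The recursion starts from a finite net of words, which exists since `SU(d)`
is compact (`exists_net`).

The program has only arithmetic, square roots and comparisons at its disposal, so `V` and `W` have
to be found without eigenvalues or exponentials. Let `K` be the traceless skew-Hermitian part of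
`Δ`, which differs from `Δ - 1` by `O(σ⁴)`. A bounded number of real rotations in coordinate
planes, each of which solves a quadratic equation, conjugates `K` to a matrix with zero diagonal
(`diag_conj_diagonalKiller`). Such a matrix is a Lie bracket `[X, Y]` in which `Y` is diagonal
with equally spaced entries, and dividing by the differences of these entries gives `X`; both have
order `σ` when the spacing is of order `√‖K‖`. It is enough to find special unitary
`V = 1 + X + O(σ²)` and `W = 1 + Y + O(σ²)`: for `V` a product of rotations in coordinate planes,
for `W` a diagonal matrix of phases.

A function of the registers is called computable (`IsComputable`) if a decision tree, whose
branches compare arithmetical expressions in the registers, selects an expression for its value.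
As a procedure call evaluates all its arguments in the same state, a computable matrix can
be passed to a procedure, or written to the registers, by a command of bounded cost
(`exists_call`).
-/

noncomputable section

namespace SolovayKitaev

/-! ### Decision trees and computable functions -/

/-- Decision trees that compare values of expressions in the real registers. -/
inductive DecisionTree (α : Type) : Type
  | leaf (a : α) : DecisionTree α
  | branch (a b : RExpr) (t t' : DecisionTree α) : DecisionTree α

namespace DecisionTree

variable {α β : Type}

/-- The leaf that is reached when the registers contain `r`. -/
def select (r : ℕ → ℝ) : DecisionTree α → α
  | .leaf a => a
  | .branch a b t t' => if a.eval r ≤ b.eval r then t.select r else t'.select r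

/-- Replace each leaf by a tree. -/
def bind (t : DecisionTree α) (k : α → DecisionTree β) : DecisionTree β :=
  match t with
  | .leaf a => k a
  | .branch a b t t' => .branch a b (t.bind k) (t'.bind k)

theorem select_bind (r : ℕ → ℝ) (t : DecisionTree α) (k : α → DecisionTree β) :
    (t.bind k).select r = (k (t.select r)).select r := by
  induction t with
  | leaf a => rfl
  | branch a b t t' h h' =>
    simp only [bind, select]
    split_ifs <;> assumption

/-- Functions on the leaves are bounded, as there are finitely many leaves. -/
theorem exists_bound (t : DecisionTree α) (g : α → ℕ) : ∃ B, ∀ r, g (t.select r) ≤ B := by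
  induction t with
  | leaf a => exact ⟨g a, fun r => le_rfl⟩
  | branch a b t t' h h' =>
    obtain ⟨B, hB⟩ := h
    obtain ⟨B', hB'⟩ := h'
    refine ⟨max B B', fun r => ?_⟩
    simp only [select]
    split_ifs
    · exact (hB r).trans (le_max_left _ _)
    · exact (hB' r).trans (le_max_right _ _)

/-- The command that descends a tree of commands by means of `ifLE` and runs the command at the
leaf it reaches. -/
def toCmd {Γ : Type} : DecisionTree (Cmd Γ) → Cmd Γ
  | .leaf c => c
  | .branch a b t t' => .ifLE a b t.toCmd t'.toCmd

/-- A bound for the cost of the comparisons on a path of the tree. -/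
def cost : DecisionTree α → ℕ
  | .leaf _ => 0
  | .branch a b t t' => a.cost + b.cost + 1 + (t.cost + t'.cost)

theorem exec_toCmd {Γ : Type} {P : Program Γ} (t : DecisionTree (Cmd Γ)) {s s' : State Γ} {u : ℕ}
    (h : Exec P (t.select s.reg) s u s') : ∃ u' ≤ u + t.cost, Exec P t.toCmd s u' s' := by
  induction t with
  | leaf c => exact ⟨u, by simp [cost], h⟩
  | branch a b t t' ih ih' =>
    simp only [select] at h
    split_ifs at h with hc
    · obtain ⟨v, hv, hx⟩ := ih h
      exact ⟨_, by simp only [cost]; omega, Exec.ifTrue hc hx⟩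
    · obtain ⟨v, hv, hx⟩ := ih' h
      exact ⟨_, by simp only [cost]; omega, Exec.ifFalse (not_le.1 hc) hx⟩

end DecisionTree

open DecisionTree

/-- A real function of the contents of the registers is computable (without procedure calls) if a
decision tree selects an expression for its value. -/
def IsComputable (f : (ℕ → ℝ) → ℝ) : Prop :=
  ∃ t : DecisionTree RExpr, ∀ r, (t.select r).eval r = f r

namespace IsComputable

variable {f g : (ℕ → ℝ) → ℝ}

theorem const (c : ℝ) : IsComputable fun _ => c := ⟨.leaf (.const c), fun _ => rfl⟩

theorem reg (x : ℕ) : IsComputable fun r => r x := ⟨.leaf (.reg x), fun _ => rfl⟩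

theorem map₂ {op : RExpr → RExpr → RExpr} {o : ℝ → ℝ → ℝ}
    (hop : ∀ a b r, (op a b).eval r = o (a.eval r) (b.eval r))
    (hf : IsComputable f) (hg : IsComputable g) : IsComputable fun r => o (f r) (g r) := by
  obtain ⟨t, ht⟩ := hf
  obtain ⟨u, hu⟩ := hg
  refine ⟨t.bind fun a => u.bind fun b => .leaf (op a b), fun r => ?_⟩
  simp only [select_bind, select, hop, ht, hu]

theorem add (hf : IsComputable f) (hg : IsComputable g) : IsComputable fun r => f r + g r :=
  map₂ (op := .add) (fun _ _ _ => rfl) hf hg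

theorem sub (hf : IsComputable f) (hg : IsComputable g) : IsComputable fun r => f r - g r :=
  map₂ (op := .sub) (fun _ _ _ => rfl) hf hg

theorem mul (hf : IsComputable f) (hg : IsComputable g) : IsComputable fun r => f r * g r :=
  map₂ (op := .mul) (fun _ _ _ => rfl) hf hg

theorem div (hf : IsComputable f) (hg : IsComputable g) : IsComputable fun r => f r / g r :=
  map₂ (op := .div) (fun _ _ _ => rfl) hf hg

theorem neg (hf : IsComputable f) : IsComputable fun r => -f r := by
  simpa using (const 0).sub hf

theorem sqrt (hf : IsComputable f) : IsComputable fun r => Real.sqrt (f r) := by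
  obtain ⟨t, ht⟩ := hf
  refine ⟨t.bind fun a => .leaf (.sqrt a), fun r => ?_⟩
  simp only [select_bind, select, RExpr.eval, ht]

theorem sum {ι : Type*} (s : Finset ι) {F : ι → (ℕ → ℝ) → ℝ} (hF : ∀ i, IsComputable (F i)) :
    IsComputable fun r => ∑ i ∈ s, F i r := by
  classical
  induction s using Finset.induction_on with
  | empty => simpa using const 0
  | insert a s ha ih => simpa [Finset.sum_insert ha] using (hF a).add ih

end IsComputable

/-- A comparison of computable functions can be put on top of two decision trees. -/
theorem exists_tree_ite {α : Type} {f g : (ℕ → ℝ) → ℝ} (hf : IsComputable f)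
    (hg : IsComputable g) (u u' : DecisionTree α) : ∃ t : DecisionTree α, ∀ r,
      (f r ≤ g r → t.select r = u.select r) ∧ (¬ f r ≤ g r → t.select r = u'.select r) := by
  obtain ⟨tf, hf⟩ := hf
  obtain ⟨tg, hg⟩ := hg
  refine ⟨tf.bind fun a => tg.bind fun b => .branch a b u u', fun r => ?_⟩
  simp only [select_bind, select, hf, hg]
  exact ⟨fun h => if_pos h, fun h => if_neg h⟩

theorem IsComputable.ite {f g h h' : (ℕ → ℝ) → ℝ} (hf : IsComputable f) (hg : IsComputable g)
    (hh : IsComputable h) (hh' : IsComputable h') :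
    IsComputable fun r => if f r ≤ g r then h r else h' r := by
  obtain ⟨u, hu⟩ := hh
  obtain ⟨u', hu'⟩ := hh'
  obtain ⟨t, ht⟩ := exists_tree_ite hf hg u u'
  refine ⟨t, fun r => ?_⟩
  by_cases hc : f r ≤ g r
  · simp only [(ht r).1 hc, hu, if_pos hc]
  · simp only [(ht r).2 hc, hu', if_neg hc]

/-- Finitely many computable functions can be evaluated by a single decision tree. -/
theorem exists_tree_pi {n : ℕ} {F : Fin n → (ℕ → ℝ) → ℝ} (hF : ∀ i, IsComputable (F i)) :
    ∃ t : DecisionTree (Fin n → RExpr), ∀ r i, (t.select r i).eval r = F i r := by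
  induction n with
  | zero => exact ⟨.leaf Fin.elim0, fun r i => i.elim0⟩
  | succ n ih =>
    obtain ⟨t, ht⟩ := ih (F := fun i => F i.succ) fun i => hF _
    obtain ⟨u, hu⟩ := hF 0
    refine ⟨u.bind fun a => t.bind fun v => .leaf (Fin.cons a v), fun r i => ?_⟩
    simp only [select_bind, select]
    refine Fin.cases ?_ (fun j => ?_) i
    · simpa using hu r
    · simpa using ht r j

/-- A complex function of the registers is computable if its real and imaginary parts are. -/
def IsComputableC (f : (ℕ → ℝ) → ℂ) : Prop :=
  (IsComputable fun r => (f r).re) ∧ IsComputable fun r => (f r).im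

namespace IsComputableC

variable {f g : (ℕ → ℝ) → ℂ}

theorem const (c : ℂ) : IsComputableC fun _ => c := ⟨.const _, .const _⟩

theorem ofReal {f : (ℕ → ℝ) → ℝ} (hf : IsComputable f) : IsComputableC fun r => (f r : ℂ) :=
  ⟨by simpa using hf, by simpa using IsComputable.const 0⟩

theorem add (hf : IsComputableC f) (hg : IsComputableC g) : IsComputableC fun r => f r + g r :=
  ⟨by simpa using hf.1.add hg.1, by simpa using hf.2.add hg.2⟩

theorem neg (hf : IsComputableC f) : IsComputableC fun r => -f r :=
  ⟨by simpa using hf.1.neg, by simpa using hf.2.neg⟩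

theorem sub (hf : IsComputableC f) (hg : IsComputableC g) : IsComputableC fun r => f r - g r :=
  ⟨by simpa using hf.1.sub hg.1, by simpa using hf.2.sub hg.2⟩

theorem mul (hf : IsComputableC f) (hg : IsComputableC g) : IsComputableC fun r => f r * g r :=
  ⟨by simpa using (hf.1.mul hg.1).sub (hf.2.mul hg.2),
    by simpa using (hf.1.mul hg.2).add (hf.2.mul hg.1)⟩

theorem star (hf : IsComputableC f) : IsComputableC fun r => star (f r) :=
  ⟨by simpa using hf.1, by simpa using hf.2.neg⟩

theorem normSq (hf : IsComputableC f) : IsComputable fun r => Complex.normSq (f r) := by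
  simpa [Complex.normSq_apply] using (hf.1.mul hf.1).add (hf.2.mul hf.2)

theorem norm (hf : IsComputableC f) : IsComputable fun r => ‖f r‖ := by
  simpa [Complex.norm_def] using hf.normSq.sqrt

theorem sum {ι : Type*} (s : Finset ι) {F : ι → (ℕ → ℝ) → ℂ} (hF : ∀ i, IsComputableC (F i)) :
    IsComputableC fun r => ∑ i ∈ s, F i r :=
  ⟨by simpa using IsComputable.sum s fun i => (hF i).1,
    by simpa using IsComputable.sum s fun i => (hF i).2⟩

end IsComputableC

/-- A matrix-valued function of the registers is computable if its entries are. -/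
def IsComputableM {m n : Type*} (M : (ℕ → ℝ) → Matrix m n ℂ) : Prop :=
  ∀ i j, IsComputableC fun r => M r i j

namespace IsComputableM

variable {l m n : Type*} {M N : (ℕ → ℝ) → Matrix m n ℂ}

theorem const (A : Matrix m n ℂ) : IsComputableM fun _ => A := fun i j => .const (A i j)

theorem add (hM : IsComputableM M) (hN : IsComputableM N) : IsComputableM fun r => M r + N r :=
  fun i j => (hM i j).add (hN i j)

theorem sub (hM : IsComputableM M) (hN : IsComputableM N) : IsComputableM fun r => M r - N r :=
  fun i j => (hM i j).sub (hN i j)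

theorem smul {f : (ℕ → ℝ) → ℂ} (hf : IsComputableC f) (hM : IsComputableM M) :
    IsComputableM fun r => f r • M r :=
  fun i j => hf.mul (hM i j)

theorem conjTranspose (hM : IsComputableM M) : IsComputableM fun r => (M r).conjTranspose :=
  fun i j => (hM j i).star

theorem mul [Fintype m] {L : (ℕ → ℝ) → Matrix l m ℂ} (hL : IsComputableM L)
    (hM : IsComputableM M) : IsComputableM fun r => L r * M r := fun i j => by
  simpa only [Matrix.mul_apply] using IsComputableC.sum _ fun k => (hL i k).mul (hM k j)

theorem ite {f g : (ℕ → ℝ) → ℝ} (hf : IsComputable f) (hg : IsComputable g)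
    (hM : IsComputableM M) (hN : IsComputableM N) :
    IsComputableM fun r => if f r ≤ g r then M r else N r := fun i j => by
  constructor
  · convert! hf.ite hg (hM i j).1 (hN i j).1 using 2 with r
    by_cases h : f r ≤ g r <;> simp [h]
  · convert! hf.ite hg (hM i j).2 (hN i j).2 using 2 with r
    by_cases h : f r ≤ g r <;> simp [h]

theorem listProd [Fintype n] [DecidableEq n] {ι : Type*} (l : List ι)
    {F : ι → (ℕ → ℝ) → Matrix n n ℂ} (hF : ∀ i, IsComputableM (F i)) :
    IsComputableM fun r => (l.map fun i => F i r).prod := by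
  induction l with
  | nil => simpa using const 1
  | cons a l ih => simpa using (hF a).mul ih

end IsComputableM

/-! ### Compressed sequences -/

section Store

variable {Γ : Type}

theorem storeWords_append_singleton (h : List (Cell Γ)) (c : Cell Γ) :
    storeWords (h ++ [c]) = storeWords h ++ [c.word (storeWords h)] := by
  simp [storeWords]

theorem length_storeWords (h : List (Cell Γ)) : (storeWords h).length = h.length := by
  induction h using List.reverseRecOn with
  | nil => rfl
  | append_singleton h c ih => simp [storeWords_append_singleton, ih]

theorem storeWord_append_singleton_length (h : List (Cell Γ)) (c : Cell Γ) :
    storeWord (h ++ [c]) h.length = c.word (storeWords h) := by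
  rw [storeWord, storeWords_append_singleton, List.getD_append_right _ _ _ _
    (length_storeWords h).le]
  simp [length_storeWords]

/-- Cells keep their meaning when further cells are stored. -/
theorem storeWord_append (h h' : List (Cell Γ)) {p : ℕ} (hp : p < h.length) :
    storeWord (h ++ h') p = storeWord h p := by
  induction h' using List.reverseRecOn with
  | nil => simp
  | append_singleton h' c ih =>
    rw [← ih, ← List.append_assoc, storeWord, storeWords_append_singleton,
      List.getD_append _ _ _ _ (by rw [length_storeWords, List.length_append]; omega)]
    rfl

/-- The pointer `p` is valid for the store `h` and denotes the sequence `w`. -/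
def Denotes (h : List (Cell Γ)) (p : ℕ) (w : List Γ) : Prop :=
  p < h.length ∧ storeWord h p = w

theorem Denotes.mono {h h' : List (Cell Γ)} {p : ℕ} {w : List Γ} (hp : Denotes h p w)
    (hh : h <+: h') : Denotes h' p w := by
  obtain ⟨e, rfl⟩ := hh
  exact ⟨by have := hp.1; rw [List.length_append]; omega, by rw [storeWord_append _ _ hp.1, hp.2]⟩

theorem denotes_empty (h : List (Cell Γ)) : Denotes (h ++ [Cell.empty]) h.length [] :=
  ⟨by simp, by rw [storeWord_append_singleton_length]; rfl⟩

theorem denotes_letter (h : List (Cell Γ)) (g : Γ) :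
    Denotes (h ++ [Cell.letter g]) h.length [g] :=
  ⟨by simp, by rw [storeWord_append_singleton_length]; rfl⟩

theorem Denotes.concat {h : List (Cell Γ)} {p q : ℕ} {v w : List Γ} (hp : Denotes h p v)
    (hq : Denotes h q w) : Denotes (h ++ [Cell.concat p q]) h.length (v ++ w) :=
  ⟨by simp, by rw [storeWord_append_singleton_length, ← hp.2, ← hq.2]; rfl⟩

end Store

open scoped Matrix.Norms.L2Operator Matrix

/-! ### The operator norm -/

section Norm

variable {d : ℕ}

theorem opDist_eq_norm (U S : SU d) :
    opDist U S = ‖(U : Matrix (Fin d) (Fin d) ℂ) - (S : Matrix (Fin d) (Fin d) ℂ)‖ := rfl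

theorem norm_entry_le (A : Matrix (Fin d) (Fin d) ℂ) (i j : Fin d) : ‖A i j‖ ≤ ‖A‖ := by
  have h := (Matrix.toEuclideanCLM (n := Fin d) (𝕜 := ℂ) A).le_opNorm
    (WithLp.toLp 2 (Pi.single j 1))
  have h2 := PiLp.norm_apply_le (Matrix.toEuclideanCLM (n := Fin d) (𝕜 := ℂ) A
    (WithLp.toLp 2 (Pi.single j 1))) i
  rw [Matrix.l2_opNorm_toEuclideanCLM] at h
  simpa using h2.trans h

theorem norm_single_le (i j : Fin d) (a : ℂ) : ‖Matrix.single i j a‖ ≤ ‖a‖ := by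
  have h := Matrix.l2_opNorm_conjTranspose_mul_self (Matrix.single i j a)
  rw [Matrix.conjTranspose_single, Matrix.single_mul_single_same,
    ← Matrix.diagonal_single, Matrix.l2_opNorm_diagonal, Pi.norm_single, norm_mul,
    norm_star] at h
  nlinarith [norm_nonneg a, norm_nonneg (Matrix.single i j a)]

theorem norm_le_sum_entries (A : Matrix (Fin d) (Fin d) ℂ) : ‖A‖ ≤ ∑ i, ∑ j, ‖A i j‖ := by
  conv_lhs => rw [Matrix.matrix_eq_sum_single A]
  exact (norm_sum_le _ _).trans (Finset.sum_le_sum fun i _ => (norm_sum_le _ _).trans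
    (Finset.sum_le_sum fun j _ => norm_single_le _ _ _))

theorem norm_one_le : ‖(1 : Matrix (Fin d) (Fin d) ℂ)‖ ≤ 1 := by
  rw [← Matrix.diagonal_one, Matrix.l2_opNorm_diagonal]
  exact (pi_norm_le_iff_of_nonneg zero_le_one).2 fun i => by simp

theorem norm_unitary_le {U : Matrix (Fin d) (Fin d) ℂ} (hU : U ∈ Matrix.unitaryGroup (Fin d) ℂ) :
    ‖U‖ ≤ 1 := by
  have h := CStarRing.norm_mul_mem_unitary (1 : Matrix (Fin d) (Fin d) ℂ) hU
  rw [one_mul] at h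
  exact h.trans_le norm_one_le

theorem norm_mul_unitary (A : Matrix (Fin d) (Fin d) ℂ) {U : Matrix (Fin d) (Fin d) ℂ}
    (hU : U ∈ Matrix.unitaryGroup (Fin d) ℂ) : ‖A * U‖ = ‖A‖ :=
  CStarRing.norm_mul_mem_unitary A hU

theorem norm_unitary_mul {U : Matrix (Fin d) (Fin d) ℂ} (hU : U ∈ Matrix.unitaryGroup (Fin d) ℂ)
    (A : Matrix (Fin d) (Fin d) ℂ) : ‖U * A‖ = ‖A‖ :=
  CStarRing.norm_mem_unitary_mul A hU

/-- Conjugation by a unitary matrix preserves the operator norm. -/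
theorem norm_conj_unitary {U : Matrix (Fin d) (Fin d) ℂ} (hU : U ∈ Matrix.unitaryGroup (Fin d) ℂ)
    (A : Matrix (Fin d) (Fin d) ℂ) : ‖U * A * Uᴴ‖ = ‖A‖ := by
  rw [← Matrix.star_eq_conjTranspose, norm_mul_unitary _ (Unitary.star_mem hU), norm_unitary_mul hU]

end Norm

/-! ### Two-level rotations -/

section TwoLevel

variable {d : ℕ}

/-- The isometry `ℂ² → ℂ^d` onto the coordinate plane of `j` and `k` (for `j ≠ k`). -/
def planeEmbedding (j k : Fin d) : Matrix (Fin d) (Fin 2) ℂ :=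
  Matrix.of fun i => ![if i = j then 1 else 0, if i = k then 1 else 0]

/-- The factor `1 / √(1 + |z|²)` that makes `!![1, z; -z̄, 1]` unitary. -/
def rotScale (z : ℂ) : ℝ := 1 / Real.sqrt (1 + Complex.normSq z)

/-- The element `(1 + |z|²)^(-1/2) • !![1, z; -z̄, 1]` of `SU(2)`. -/
def rotation (z : ℂ) : Matrix (Fin 2) (Fin 2) ℂ :=
  (rotScale z : ℂ) • !![1, z; -star z, 1]

/-- The matrix which acts as `rotation z` on the plane of the coordinates `j ≠ k`, and trivially
on the other coordinates. -/
def twoLevel (j k : Fin d) (z : ℂ) : Matrix (Fin d) (Fin d) ℂ :=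
  1 + planeEmbedding j k * (rotation z - 1) * (planeEmbedding j k)ᴴ

theorem planeEmbedding_isometry {j k : Fin d} (h : j ≠ k) :
    (planeEmbedding j k)ᴴ * planeEmbedding j k = 1 := by
  ext a b
  fin_cases a <;> fin_cases b <;>
    simp [planeEmbedding, Matrix.mul_apply, h, h.symm, apply_ite]

theorem rotScale_sq (z : ℂ) : (rotScale z) ^ 2 * (1 + Complex.normSq z) = 1 := by
  have h : 0 < 1 + Complex.normSq z := by have := Complex.normSq_nonneg z; linarith
  rw [rotScale, div_pow, Real.sq_sqrt h.le]
  field_simp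

theorem rotScale_pos (z : ℂ) : 0 < rotScale z := by
  have h : 0 < 1 + Complex.normSq z := by have := Complex.normSq_nonneg z; linarith
  rw [rotScale]
  positivity

theorem rotScale_le_one (z : ℂ) : rotScale z ≤ 1 := by
  have := rotScale_sq z
  have h1 := Complex.normSq_nonneg z
  have h2 := rotScale_pos z
  nlinarith [sq_nonneg (rotScale z)]

theorem one_sub_rotScale_le (z : ℂ) : 1 - rotScale z ≤ ‖z‖ ^ 2 := by
  have := rotScale_sq z
  have h2 := rotScale_pos z
  have h3 := rotScale_le_one z
  have h1 := Complex.normSq_nonneg z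
  rw [← Complex.normSq_eq_norm_sq]
  have h4 : (rotScale z) ^ 2 * Complex.normSq z ≤ Complex.normSq z := by
    nlinarith [sq_nonneg (rotScale z)]
  nlinarith

theorem norm_rotScale_sub_one_le (z : ℂ) : ‖(rotScale z : ℂ) - 1‖ ≤ ‖z‖ ^ 2 := by
  have h3 := rotScale_le_one z
  rw [← Complex.ofReal_one, ← Complex.ofReal_sub, Complex.norm_real, Real.norm_eq_abs,
    abs_of_nonpos (by linarith)]
  linarith [one_sub_rotScale_le z]

theorem norm_rotScale_sub_one_le_one (z : ℂ) : ‖(rotScale z : ℂ) - 1‖ ≤ 1 := by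
  have h3 := rotScale_le_one z
  have h2 := rotScale_pos z
  rw [← Complex.ofReal_one, ← Complex.ofReal_sub, Complex.norm_real, Real.norm_eq_abs,
    abs_of_nonpos (by linarith)]
  linarith

theorem rotation_mul_conjTranspose (z : ℂ) : rotation z * (rotation z)ᴴ = 1 := by
  have h : ((rotScale z : ℂ)) ^ 2 * (1 + z * star z) = 1 := by
    have := congrArg (fun x : ℝ => (x : ℂ)) (rotScale_sq z)
    push_cast at this
    rwa [← Complex.mul_conj] at this
  ext a b
  simp only [RCLike.star_def] at h
  fin_cases a <;> fin_cases b <;> simp [rotation, Matrix.mul_apply]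
  · linear_combination h
  · ring
  · ring
  · linear_combination h

theorem det_rotation (z : ℂ) : (rotation z).det = 1 := by
  have h : ((rotScale z : ℂ)) ^ 2 * (1 + z * star z) = 1 := by
    have := congrArg (fun x : ℝ => (x : ℂ)) (rotScale_sq z)
    push_cast at this
    rwa [← Complex.mul_conj] at this
  rw [rotation, Matrix.det_smul, Matrix.det_fin_two_of, Fintype.card_fin]
  linear_combination h

theorem twoLevel_mem_unitaryGroup {j k : Fin d} (h : j ≠ k) (z : ℂ) :
    twoLevel j k z ∈ Matrix.unitaryGroup (Fin d) ℂ := by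
  rw [Matrix.mem_unitaryGroup_iff]
  set E := planeEmbedding j k with hE
  set N := rotation z - 1 with hN
  have hN1 : N + Nᴴ + N * Nᴴ = 0 := by
    have := rotation_mul_conjTranspose z
    have h2 : rotation z = 1 + N := by rw [hN]; abel
    rw [h2, Matrix.conjTranspose_add, Matrix.conjTranspose_one] at this
    have h3 : (1 + N) * (1 + Nᴴ) = 1 + (N + Nᴴ + N * Nᴴ) := by noncomm_ring
    rw [h3] at this
    simpa using this
  have hE1 : Eᴴ * E = 1 := planeEmbedding_isometry h
  have hstar : star (twoLevel j k z) = 1 + E * Nᴴ * Eᴴ := by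
    rw [Matrix.star_eq_conjTranspose, twoLevel, Matrix.conjTranspose_add,
      Matrix.conjTranspose_one, Matrix.conjTranspose_mul, Matrix.conjTranspose_mul,
      Matrix.conjTranspose_conjTranspose, Matrix.mul_assoc]
  rw [hstar, twoLevel]
  have h5 : E * N * Eᴴ * (E * Nᴴ * Eᴴ) = E * (N * Nᴴ) * Eᴴ := by
    calc E * N * Eᴴ * (E * Nᴴ * Eᴴ) = E * N * (Eᴴ * E) * Nᴴ * Eᴴ := by
          simp only [Matrix.mul_assoc]
      _ = _ := by rw [hE1, Matrix.mul_one]; simp only [Matrix.mul_assoc]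
  have h6 : E * N * Eᴴ + E * Nᴴ * Eᴴ + E * (N * Nᴴ) * Eᴴ = 0 := by
    rw [← Matrix.add_mul, ← Matrix.mul_add, ← Matrix.add_mul, ← Matrix.mul_add, hN1]
    simp
  calc (1 + E * N * Eᴴ) * (1 + E * Nᴴ * Eᴴ)
      = 1 + (E * N * Eᴴ + E * Nᴴ * Eᴴ + E * N * Eᴴ * (E * Nᴴ * Eᴴ)) := by
        rw [Matrix.add_mul, Matrix.mul_add, Matrix.mul_add]
        simp only [Matrix.one_mul, Matrix.mul_one]
        abel
    _ = 1 := by rw [h5, h6, add_zero]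

theorem det_twoLevel {j k : Fin d} (h : j ≠ k) (z : ℂ) : (twoLevel j k z).det = 1 := by
  rw [twoLevel, Matrix.mul_assoc, Matrix.det_one_add_mul_comm, Matrix.mul_assoc,
    planeEmbedding_isometry h, Matrix.mul_one, add_sub_cancel, det_rotation]

/-- The infinitesimal rotation to which `twoLevel j k z` is tangent. -/
def twoLevelTangent (j k : Fin d) (z : ℂ) : Matrix (Fin d) (Fin d) ℂ :=
  Matrix.single j k z - Matrix.single k j (star z)

theorem twoLevel_eq (j k : Fin d) (z : ℂ) :
    twoLevel j k z = 1 + ((rotScale z : ℂ) - 1) • (Matrix.single j j 1 + Matrix.single k k 1)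
      + (rotScale z : ℂ) • twoLevelTangent j k z := by
  have key : ∀ N : Matrix (Fin 2) (Fin 2) ℂ, planeEmbedding j k * N * (planeEmbedding j k)ᴴ =
      N 0 0 • Matrix.single j j 1 + N 0 1 • Matrix.single j k 1 + N 1 0 • Matrix.single k j 1
        + N 1 1 • Matrix.single k k 1 := by
    intro N
    ext a b
    simp only [planeEmbedding, Matrix.mul_apply, Matrix.add_apply, Matrix.single_apply,
      Matrix.smul_apply, Fin.sum_univ_two, Matrix.of_apply, Matrix.conjTranspose_apply]
    simp only [Matrix.cons_val_zero, Matrix.cons_val_one, eq_comm (a := j), eq_comm (a := k),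
      ite_and, apply_ite (star : ℂ → ℂ), star_one, star_zero]
    split_ifs <;> simp [add_comm, add_left_comm]
  have ht : twoLevelTangent j k z = z • Matrix.single j k 1 - star z • Matrix.single k j 1 := by
    simp [twoLevelTangent, Matrix.smul_single]
  have h00 : (rotation z - 1) 0 0 = (rotScale z : ℂ) - 1 := by simp [rotation]
  have h01 : (rotation z - 1) 0 1 = (rotScale z : ℂ) * z := by simp [rotation]
  have h10 : (rotation z - 1) 1 0 = -((rotScale z : ℂ) * star z) := by simp [rotation]
  have h11 : (rotation z - 1) 1 1 = (rotScale z : ℂ) - 1 := by simp [rotation]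
  rw [twoLevel, key, ht, h00, h01, h10, h11]
  module

theorem norm_twoLevelTangent_le (j k : Fin d) (z : ℂ) : ‖twoLevelTangent j k z‖ ≤ 2 * ‖z‖ := by
  refine (norm_sub_le _ _).trans ?_
  have h1 := norm_single_le j k z
  have h2 := norm_single_le k j (star z)
  rw [norm_star] at h2
  linarith

theorem norm_twoLevel_sub_tangent_le (j k : Fin d) (z : ℂ) :
    ‖twoLevel j k z - 1 - twoLevelTangent j k z‖ ≤ 4 * ‖z‖ ^ 2 := by
  have h : twoLevel j k z - 1 - twoLevelTangent j k z =
      ((rotScale z : ℂ) - 1) • (Matrix.single j j 1 + Matrix.single k k 1)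
      + ((rotScale z : ℂ) - 1) • twoLevelTangent j k z := by
    rw [twoLevel_eq]
    module
  rw [h]
  have h1 := norm_add_le (Matrix.single j j (1 : ℂ)) (Matrix.single k k 1)
  have h2 := norm_single_le j j (1 : ℂ)
  have h3 := norm_single_le k k (1 : ℂ)
  rw [norm_one] at h2 h3
  have h4 := norm_twoLevelTangent_le j k z
  have h5 := norm_rotScale_sub_one_le z
  -- for large `z` the bound `|rotScale z - 1| ≤ |z|²` alone would give a cubic term
  have h6 : ‖(rotScale z : ℂ) - 1‖ ≤ ‖z‖ := by
    have := norm_rotScale_sub_one_le_one z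
    rcases le_total 1 ‖z‖ with h | h <;> nlinarith [norm_nonneg z]
  refine (norm_add_le _ _).trans ?_
  rw [norm_smul, norm_smul]
  nlinarith [norm_nonneg z, norm_nonneg ((rotScale z : ℂ) - 1),
    mul_le_mul h6 h4 (norm_nonneg _) (norm_nonneg z),
    mul_le_mul h5 (h1.trans (add_le_add h2 h3)) (norm_nonneg _) (sq_nonneg ‖z‖)]

theorem norm_twoLevel_sub_one_le (j k : Fin d) (z : ℂ) : ‖twoLevel j k z - 1‖ ≤ 4 * ‖z‖ := by
  have h : twoLevel j k z - 1 =
      ((rotScale z : ℂ) - 1) • (Matrix.single j j 1 + Matrix.single k k 1)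
      + (rotScale z : ℂ) • twoLevelTangent j k z := by
    rw [twoLevel_eq]
    module
  rw [h]
  have h1 := norm_add_le (Matrix.single j j (1 : ℂ)) (Matrix.single k k 1)
  have h2 := norm_single_le j j (1 : ℂ)
  have h3 := norm_single_le k k (1 : ℂ)
  rw [norm_one] at h2 h3
  have h4 := norm_twoLevelTangent_le j k z
  have h5 := norm_rotScale_sub_one_le z
  have h6 : ‖(rotScale z : ℂ) - 1‖ ≤ ‖z‖ := by
    have := norm_rotScale_sub_one_le_one z
    rcases le_total 1 ‖z‖ with h | h <;> nlinarith [norm_nonneg z]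
  have h7 : ‖(rotScale z : ℂ)‖ ≤ 1 := by
    rw [Complex.norm_real, Real.norm_eq_abs, abs_of_pos (rotScale_pos z)]
    exact rotScale_le_one z
  refine (norm_add_le _ _).trans ?_
  rw [norm_smul, norm_smul]
  nlinarith [norm_nonneg z, norm_nonneg ((rotScale z : ℂ) - 1),
    mul_le_mul h7 h4 (norm_nonneg _) zero_le_one,
    mul_le_mul h6 (h1.trans (add_le_add h2 h3)) (norm_nonneg _) (norm_nonneg z)]

theorem prod_twoLevel_mem_unitaryGroup (l : List (Fin d × Fin d)) (hl : ∀ p ∈ l, p.1 ≠ p.2)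
    (z : Fin d × Fin d → ℂ) :
    (l.map fun p => twoLevel p.1 p.2 (z p)).prod ∈ Matrix.unitaryGroup (Fin d) ℂ := by
  refine Submonoid.list_prod_mem _ fun A hA => ?_
  obtain ⟨p, hp, rfl⟩ := List.mem_map.1 hA
  exact twoLevel_mem_unitaryGroup (hl p hp) _

theorem det_prod_twoLevel (l : List (Fin d × Fin d)) (hl : ∀ p ∈ l, p.1 ≠ p.2)
    (z : Fin d × Fin d → ℂ) : (l.map fun p => twoLevel p.1 p.2 (z p)).prod.det = 1 := by
  refine Submonoid.list_prod_mem (MonoidHom.mker (Matrix.detMonoidHom (n := Fin d) (R := ℂ)))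
    fun A hA => ?_
  obtain ⟨p, hp, rfl⟩ := List.mem_map.1 hA
  exact det_twoLevel (hl p hp) _

/-- Products of two-level rotations by small angles are tangent to the sums of the infinitesimal
rotations. -/
theorem exists_norm_prod_twoLevel_le (l : List (Fin d × Fin d)) (hl : ∀ p ∈ l, p.1 ≠ p.2) :
    ∃ C : ℝ, 0 ≤ C ∧ ∀ (z : Fin d × Fin d → ℂ) (s : ℝ), (∀ p, ‖z p‖ ≤ s) →
      ‖(l.map fun p => twoLevel p.1 p.2 (z p)).prod - 1‖ ≤ C * s ∧
      ‖(l.map fun p => twoLevel p.1 p.2 (z p)).prod - 1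
        - (l.map fun p => twoLevelTangent p.1 p.2 (z p)).sum‖ ≤ C * s ^ 2 := by
  induction l with
  | nil => exact ⟨0, le_rfl, fun z s _ => by simp⟩
  | cons p l ih =>
    obtain ⟨C, hC, h⟩ := ih fun q hq => hl q (List.mem_cons_of_mem _ hq)
    refine ⟨4 + C + 4 * C, by positivity, fun z s hz => ?_⟩
    obtain ⟨h1, h2⟩ := h z s hz
    have hs : 0 ≤ s := (norm_nonneg _).trans (hz p)
    have h3 : ‖twoLevel p.1 p.2 (z p) - 1‖ ≤ 4 * s :=
      (norm_twoLevel_sub_one_le _ _ _).trans (by linarith [hz p])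
    have h4 : ‖twoLevel p.1 p.2 (z p) - 1 - twoLevelTangent p.1 p.2 (z p)‖ ≤ 4 * s ^ 2 :=
      (norm_twoLevel_sub_tangent_le _ _ _).trans
        (by have := pow_le_pow_left₀ (norm_nonneg _) (hz p) 2; linarith)
    rw [List.map_cons, List.prod_cons, List.map_cons, List.sum_cons]
    set A := twoLevel p.1 p.2 (z p)
    set B := (l.map fun p => twoLevel p.1 p.2 (z p)).prod
    set X := twoLevelTangent p.1 p.2 (z p)
    set Y := (l.map fun p => twoLevelTangent p.1 p.2 (z p)).sum
    have hAB : ‖(A - 1) * (B - 1)‖ ≤ 4 * s * (C * s) :=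
      (norm_mul_le _ _).trans (mul_le_mul h3 h1 (norm_nonneg _) (by positivity))
    constructor
    · have e : A * B - 1 = (A - 1) * B + (B - 1) := by noncomm_ring
      have hB : B ∈ Matrix.unitaryGroup (Fin d) ℂ :=
        prod_twoLevel_mem_unitaryGroup l (fun q hq => hl q (List.mem_cons_of_mem _ hq)) z
      rw [e]
      refine (norm_add_le _ _).trans ?_
      rw [norm_mul_unitary _ hB]
      nlinarith
    · have e : A * B - 1 - (X + Y) = (A - 1 - X) + (B - 1 - Y) + (A - 1) * (B - 1) := by
        noncomm_ring
      rw [e]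
      refine (norm_add_le _ _).trans ((add_le_add_left (norm_add_le _ _) _).trans ?_)
      nlinarith

end TwoLevel

variable {d : ℕ}

theorem isComputable_rotScale {z : (ℕ → ℝ) → ℂ} (hz : IsComputableC z) :
    IsComputable fun r => rotScale (z r) :=
  (IsComputable.const 1).div ((IsComputable.const 1).add hz.normSq).sqrt

theorem isComputableM_twoLevel (j k : Fin d) {z : (ℕ → ℝ) → ℂ} (hz : IsComputableC z) :
    IsComputableM fun r => twoLevel j k (z r) := by
  have h : IsComputableM fun r => rotation (z r) := by
    refine IsComputableM.smul (.ofReal (isComputable_rotScale hz)) fun a b => ?_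
    fin_cases a <;> fin_cases b
    · exact IsComputableC.const 1
    · exact hz
    · exact hz.star.neg
    · exact IsComputableC.const 1
  exact (IsComputableM.const 1).add
    (((IsComputableM.const _).mul (h.sub (.const 1))).mul (.const _))

/-! ### Diagonal matrices of phases -/

/-- The diagonal unitary matrix with the phases `(1 + i xⱼ) / √(1 + xⱼ²)`. -/
def phaseDiagonal (x : Fin d → ℝ) : Matrix (Fin d) (Fin d) ℂ :=
  Matrix.diagonal fun j => (rotScale (x j) : ℂ) * (1 + Complex.I * x j)

theorem phase_mul_phase_neg (x : ℝ) :
    ((rotScale x : ℂ) * (1 + Complex.I * x)) * ((rotScale x : ℂ) * (1 - Complex.I * x)) = 1 := by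
  have := congrArg (fun x : ℝ => (x : ℂ)) (rotScale_sq x)
  rw [Complex.normSq_ofReal] at this
  push_cast at this
  linear_combination this - (rotScale x : ℂ) ^ 2 * x ^ 2 * Complex.I_sq

theorem rotScale_neg (z : ℂ) : rotScale (-z) = rotScale z := by
  rw [rotScale, rotScale, Complex.normSq_neg]

theorem phaseDiagonal_mem_unitaryGroup (x : Fin d → ℝ) :
    phaseDiagonal x ∈ Matrix.unitaryGroup (Fin d) ℂ := by
  rw [Matrix.mem_unitaryGroup_iff, Matrix.star_eq_conjTranspose, phaseDiagonal,
    Matrix.diagonal_conjTranspose, Matrix.diagonal_mul_diagonal, ← Matrix.diagonal_one]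
  congr 1
  ext j
  refine Eq.trans ?_ (phase_mul_phase_neg (x j))
  simp [sub_eq_add_neg]

theorem det_phaseDiagonal {x : Fin d → ℝ} (hx : ∀ j, x j.rev = -x j) :
    (phaseDiagonal x).det = 1 := by
  rw [phaseDiagonal, Matrix.det_diagonal]
  refine Finset.prod_involution (fun j _ => j.rev) (fun j _ => ?_) (fun j _ hj h => hj ?_)
    (fun _ _ => Finset.mem_univ _) (fun j _ => Fin.rev_rev j)
  · rw [hx, Complex.ofReal_neg, rotScale_neg]
    refine Eq.trans ?_ (phase_mul_phase_neg (x j))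
    ring
  · have h0 : x j = 0 := by
      have := hx j
      rw [h] at this
      linarith
    rw [h0]
    simp [rotScale]

theorem norm_phaseDiagonal_le {x : Fin d → ℝ} {s : ℝ} (hs : 0 ≤ s) (hx : ∀ j, |x j| ≤ s) :
    ‖phaseDiagonal x - 1‖ ≤ 3 * s ∧
    ‖phaseDiagonal x - 1 - Matrix.diagonal fun j => Complex.I * x j‖ ≤ 2 * s ^ 2 := by
  have hn : ∀ j, ‖(x j : ℂ)‖ ≤ s := fun j => by simpa using hx j
  have h0 : ∀ j, ‖(rotScale (x j) : ℂ) - 1‖ ≤ s ^ 2 := fun j =>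
    (norm_rotScale_sub_one_le _).trans (pow_le_pow_left₀ (norm_nonneg _) (hn j) 2)
  have h1 : ∀ j, ‖(rotScale (x j) : ℂ) - 1‖ ≤ 1 := fun j => norm_rotScale_sub_one_le_one _
  have h2 : ∀ j, ‖(rotScale (x j) : ℂ) - 1‖ ≤ s := fun j => by
    rcases le_total 1 s with h | h
    · exact (h1 j).trans h
    · exact (h0 j).trans (by nlinarith)
  constructor
  · rw [phaseDiagonal, ← Matrix.diagonal_one, Matrix.diagonal_sub, Matrix.l2_opNorm_diagonal,
      pi_norm_le_iff_of_nonneg (by positivity)]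
    intro j
    have e : (rotScale (x j) : ℂ) * (1 + Complex.I * x j) - 1 =
      ((rotScale (x j) : ℂ) - 1) + ((rotScale (x j) : ℂ) - 1) * (Complex.I * x j)
        + Complex.I * x j := by ring
    rw [e]
    refine (norm_add_le _ _).trans ((add_le_add_left (norm_add_le _ _) _).trans ?_)
    rw [norm_mul _ (Complex.I * _), norm_mul Complex.I, Complex.norm_I, one_mul]
    nlinarith [h1 j, h2 j, hn j, norm_nonneg (x j : ℂ), norm_nonneg ((rotScale (x j) : ℂ) - 1)]
  · rw [phaseDiagonal, ← Matrix.diagonal_one, Matrix.diagonal_sub, Matrix.diagonal_sub,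
      Matrix.l2_opNorm_diagonal, pi_norm_le_iff_of_nonneg (by positivity)]
    intro j
    have e : (rotScale (x j) : ℂ) * (1 + Complex.I * x j) - 1 - Complex.I * x j =
      ((rotScale (x j) : ℂ) - 1) + ((rotScale (x j) : ℂ) - 1) * (Complex.I * x j) := by ring
    rw [e]
    refine (norm_add_le _ _).trans ?_
    rw [norm_mul _ (Complex.I * _), norm_mul Complex.I, Complex.norm_I, one_mul]
    nlinarith [h0 j, h2 j, hn j, norm_nonneg (x j : ℂ), norm_nonneg ((rotScale (x j) : ℂ) - 1)]

/-! ### The determinant near the identity -/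

theorem exists_norm_prod_one_add_sub_le {ι : Type*} (S : Finset ι) :
    ∃ C : ℝ, 0 ≤ C ∧ ∀ (a : ι → ℂ) (ε : ℝ), ε ≤ 1 → (∀ i, ‖a i‖ ≤ ε) →
      ‖∏ i ∈ S, (1 + a i) - 1 - ∑ i ∈ S, a i‖ ≤ C * ε ^ 2 := by
  classical
  induction S using Finset.induction_on with
  | empty => exact ⟨0, le_rfl, fun a ε _ _ => by simp⟩
  | insert i S hi ih =>
    obtain ⟨C, hC, h⟩ := ih
    refine ⟨2 * C + S.card, by positivity, fun a ε hε1 ha => ?_⟩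
    have hε : 0 ≤ ε := (norm_nonneg _).trans (ha i)
    rw [Finset.prod_insert hi, Finset.sum_insert hi]
    have e : (1 + a i) * ∏ x ∈ S, (1 + a x) - 1 - (a i + ∑ x ∈ S, a x) =
      (1 + a i) * (∏ x ∈ S, (1 + a x) - 1 - ∑ x ∈ S, a x) + a i * ∑ x ∈ S, a x := by ring
    rw [e]
    refine (norm_add_le _ _).trans ?_
    rw [norm_mul, norm_mul]
    have h1 : ‖1 + a i‖ ≤ 2 := (norm_add_le _ _).trans (by
      rw [norm_one]; linarith [ha i])
    have h2 : ‖∑ x ∈ S, a x‖ ≤ S.card * ε := by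
      simpa using norm_sum_le_of_le S fun x _ => ha x
    have h3 := mul_le_mul h1 (h a ε hε1 ha) (norm_nonneg _) zero_le_two
    have h4 := mul_le_mul (ha i) h2 (norm_nonneg _) hε
    linarith

/-- The derivative of the determinant at the identity is the trace: in the Leibniz expansion of
`det (1 + A)`, a nontrivial permutation contributes at least two entries of `A`. -/
theorem exists_norm_det_one_add_sub_le (d : ℕ) :
    ∃ C : ℝ, 0 ≤ C ∧ ∀ (A : Matrix (Fin d) (Fin d) ℂ), ‖A‖ ≤ 1 →
      ‖(1 + A).det - 1 - A.trace‖ ≤ C * ‖A‖ ^ 2 := by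
  obtain ⟨C, hC, h⟩ := exists_norm_prod_one_add_sub_le (Finset.univ : Finset (Fin d))
  refine ⟨(Finset.univ : Finset (Equiv.Perm (Fin d))).card * 2 ^ d + C, by positivity,
    fun A hA => ?_⟩
  have h1 := h (fun i => A i i) ‖A‖ hA fun i => norm_entry_le _ _ _
  have hb : ∀ i j, ‖(1 + A) i j‖ ≤ 2 := fun i j => by
    rw [Matrix.add_apply]
    refine (norm_add_le _ _).trans ?_
    have : ‖(1 : Matrix (Fin d) (Fin d) ℂ) i j‖ ≤ 1 := by
      rw [Matrix.one_apply]; split_ifs <;> simp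
    linarith [norm_entry_le A i j]
  have h2 : ∀ σ ∈ Finset.univ.erase (1 : Equiv.Perm (Fin d)),
      ‖Equiv.Perm.sign σ • ∏ i, (1 + A) (σ i) i‖ ≤ 2 ^ d * ‖A‖ ^ 2 := by
    intro σ hσ
    have hσ1 : σ ≠ 1 := (Finset.mem_erase.1 hσ).1
    obtain ⟨i, hi⟩ : ∃ i, σ i ≠ i := by
      by_contra! hc
      exact hσ1 (Equiv.ext hc)
    have hoff : ∀ i, σ i ≠ i → ‖(1 + A) (σ i) i‖ ≤ ‖A‖ := fun i hi => by
      rw [Matrix.add_apply, Matrix.one_apply_ne hi, zero_add]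
      exact norm_entry_le _ _ _
    have hn : ‖Equiv.Perm.sign σ • ∏ i, (1 + A) (σ i) i‖ = ∏ i, ‖(1 + A) (σ i) i‖ := by
      rw [← norm_prod]
      rcases Int.units_eq_one_or (Equiv.Perm.sign σ) with h | h <;> simp [h]
    have hii : σ i ∈ Finset.univ.erase i := Finset.mem_erase.2 ⟨hi, Finset.mem_univ _⟩
    rw [hn, ← Finset.mul_prod_erase _ _ (Finset.mem_univ i), ← Finset.mul_prod_erase _ _ hii]
    have h3 : ∏ x ∈ (Finset.univ.erase i).erase (σ i), ‖(1 + A) (σ x) x‖ ≤ 2 ^ d := by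
      refine (Finset.prod_le_prod (fun _ _ => norm_nonneg _) fun x _ => hb _ _).trans ?_
      rw [Finset.prod_const]
      refine pow_le_pow_right₀ one_le_two ?_
      exact (Finset.card_le_univ _).trans (by simp)
    have h4 := hoff i hi
    have h5 := hoff (σ i) fun h => hi (σ.injective h)
    calc _ ≤ ‖A‖ * (‖A‖ * 2 ^ d) := by gcongr
      _ = _ := by ring
  rw [Matrix.det_apply, ← Finset.add_sum_erase _ _ (Finset.mem_univ (1 : Equiv.Perm (Fin d)))]
  have e : ∀ S : ℂ, (Equiv.Perm.sign (1 : Equiv.Perm (Fin d)) •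
      ∏ i, (1 + A) ((1 : Equiv.Perm (Fin d)) i) i) + S - 1 - A.trace =
      S + (∏ i, (1 + A i i) - 1 - ∑ i, A i i) := by
    intro S
    simp [Matrix.trace]
    ring
  rw [e]
  refine (norm_add_le _ _).trans ?_
  have h6 := norm_sum_le_of_le _ h2
  rw [Finset.sum_const, nsmul_eq_mul] at h6
  have h7 : (((Finset.univ.erase (1 : Equiv.Perm (Fin d))).card : ℕ) : ℝ) ≤
      (Finset.univ : Finset (Equiv.Perm (Fin d))).card := by
    exact_mod_cast Finset.card_le_card (Finset.erase_subset _ _)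
  have h8 := mul_le_mul_of_nonneg_right h7 (show 0 ≤ 2 ^ d * ‖A‖ ^ 2 by positivity)
  linarith

/-! ### Unitary conjugation to a matrix with zero diagonal -/

/-- The imaginary part of the `l`-th diagonal entry of `Rᴴ K R`.  For skew-Hermitian `K` this is the
whole entry, up to the factor `i`. -/
def conjDiag (K R : Matrix (Fin d) (Fin d) ℂ) (l : Fin d) : ℝ := ((Rᴴ * K * R) l l).im

/-- The root `t` of `h_k t² - b t + h_j = 0` for which the rotation by `t` in the plane of
`j`, `k` annihilates the `j`-th diagonal entry of `H = Rᴴ K R`, where `h_j`, `h_k` are the imaginary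
parts of the diagonal entries and `b` is that of `H j k + H k j`. -/
def annihilatingSlope (K R : Matrix (Fin d) (Fin d) ℂ) (j k : Fin d) : ℝ :=
  (((Rᴴ * K * R) j k + (Rᴴ * K * R) k j).im + Real.sqrt
    (((Rᴴ * K * R) j k + (Rᴴ * K * R) k j).im * ((Rᴴ * K * R) j k + (Rᴴ * K * R) k j).im
      - 4 * (conjDiag K R j * conjDiag K R k))) / (2 * conjDiag K R k)

/-- If the `j`-th and `k`-th diagonal entry of `Rᴴ K R` have opposite signs, compose `R` with a
rotation which makes the `j`-th entry vanish. -/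
def annihilate (K R : Matrix (Fin d) (Fin d) ℂ) (p : Fin d × Fin d) : Matrix (Fin d) (Fin d) ℂ :=
  if 0 ≤ conjDiag K R p.1 * conjDiag K R p.2 then R
  else R * twoLevel p.1 p.2 (annihilatingSlope K R p.1 p.2)

/-- Treat all pairs of indices once, in an arbitrary order. -/
def annihilateSweep (K R : Matrix (Fin d) (Fin d) ℂ) : Matrix (Fin d) (Fin d) ℂ :=
  (Finset.univ : Finset (Fin d × Fin d)).toList.foldl (annihilate K) R

/-- A unitary matrix `R` such that the diagonal of `Rᴴ K R` vanishes, for traceless skew-Hermitian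
matrices `K`.  Each sweep makes a further diagonal entry vanish, so `d` sweeps suffice. -/
def diagonalKiller (K : Matrix (Fin d) (Fin d) ℂ) : Matrix (Fin d) (Fin d) ℂ :=
  (annihilateSweep K)^[d] 1

theorem ne_of_opposite {K R : Matrix (Fin d) (Fin d) ℂ} {j k : Fin d}
    (h : ¬ 0 ≤ conjDiag K R j * conjDiag K R k) : j ≠ k := by
  rintro rfl
  exact h (mul_self_nonneg _)

theorem twoLevel_apply_of_ne {j k l : Fin d} (hj : l ≠ j) (hk : l ≠ k) (z : ℂ) (a : Fin d) :
    twoLevel j k z a l = (1 : Matrix (Fin d) (Fin d) ℂ) a l := by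
  rw [twoLevel_eq]
  simp [twoLevelTangent, hj.symm, hk.symm]

theorem conj_twoLevel_apply_of_ne (H : Matrix (Fin d) (Fin d) ℂ) {j k l : Fin d} (hj : l ≠ j)
    (hk : l ≠ k) (z : ℂ) : ((twoLevel j k z)ᴴ * H * twoLevel j k z) l l = H l l := by
  simp only [Matrix.mul_apply, Matrix.conjTranspose_apply, twoLevel_apply_of_ne hj hk]
  simp [Matrix.one_apply, apply_ite (starRingEnd ℂ)]

theorem conj_twoLevel_apply_left (H : Matrix (Fin d) (Fin d) ℂ) {j k : Fin d} (h : j ≠ k)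
    (z : ℂ) : ((twoLevel j k z)ᴴ * H * twoLevel j k z) j j =
      (rotScale z : ℂ) ^ 2 * (H j j - H j k * star z - z * H k j + z * H k k * star z) := by
  have hcol : ∀ a, twoLevel j k z a j =
      (rotScale z : ℂ) * ((if a = j then 1 else 0) - (if a = k then star z else 0)) := by
    intro a
    rw [twoLevel_eq]
    by_cases h1 : a = j <;> by_cases h2 : a = k <;>
      simp [twoLevelTangent, h, h.symm, h1, h2, eq_comm (b := a)]
  have hcol' : ∀ a, star (twoLevel j k z a j) =
      (rotScale z : ℂ) * ((if a = j then 1 else 0) - (if a = k then z else 0)) := by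
    intro a
    rw [hcol]
    by_cases h1 : a = j <;> by_cases h2 : a = k <;> simp [h1, h2, h, h.symm]
  simp only [Matrix.mul_apply, Matrix.conjTranspose_apply, hcol']
  simp only [hcol, mul_sub, sub_mul, Finset.sum_sub_distrib, mul_ite, ite_mul, mul_zero, zero_mul,
    Finset.sum_ite_eq', Finset.mem_univ, if_true, mul_one]
  ring

theorem conjDiag_mul_annihilating {K R : Matrix (Fin d) (Fin d) ℂ} {j k : Fin d}
    (h : ¬ 0 ≤ conjDiag K R j * conjDiag K R k) :
    conjDiag K (R * twoLevel j k (annihilatingSlope K R j k)) j = 0 := by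
  have hjk := ne_of_opposite h
  set t := annihilatingSlope K R j k with ht
  set H := Rᴴ * K * R with hH
  have e : (R * twoLevel j k (t : ℂ))ᴴ * K * (R * twoLevel j k (t : ℂ)) =
      (twoLevel j k (t : ℂ))ᴴ * H * twoLevel j k (t : ℂ) := by
    rw [Matrix.conjTranspose_mul, hH]
    simp only [Matrix.mul_assoc]
  have hk : conjDiag K R k ≠ 0 := fun h0 => h (by rw [h0, mul_zero])
  rw [conjDiag, e, conj_twoLevel_apply_left H hjk]
  set b := (H j k + H k j).im with hb
  have hD : 0 ≤ b * b - 4 * (conjDiag K R j * conjDiag K R k) := by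
    nlinarith [mul_self_nonneg b, not_le.1 h]
  have hroot : conjDiag K R k * t ^ 2 - b * t + conjDiag K R j = 0 := by
    have hs := Real.mul_self_sqrt hD
    have ht' : t = (b + Real.sqrt (b * b - 4 * (conjDiag K R j * conjDiag K R k))) /
      (2 * conjDiag K R k) := rfl
    rw [ht']
    set q := Real.sqrt (b * b - 4 * (conjDiag K R j * conjDiag K R k))
    field_simp
    linear_combination hs
  have e2 : (rotScale (t : ℂ) : ℂ) ^ 2 * (H j j - H j k * star (t : ℂ) - t * H k j
      + t * H k k * star (t : ℂ)) = ((rotScale (t : ℂ) ^ 2 : ℝ) : ℂ) *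
        (H j j - t * (H j k + H k j) + (t ^ 2 : ℝ) * H k k) := by
    simp only [RCLike.star_def, Complex.conj_ofReal]
    push_cast
    ring
  rw [e2, Complex.im_ofReal_mul, Complex.add_im, Complex.sub_im, Complex.im_ofReal_mul,
    Complex.im_ofReal_mul, ← hb]
  rw [conjDiag, conjDiag, ← hH] at hroot
  rw [show (H j j).im - t * b + t ^ 2 * (H k k).im = 0 by linear_combination hroot, mul_zero]

open Finset in
/-- The set of the indices of the diagonal entries that do not vanish. -/
def diagSupport (K R : Matrix (Fin d) (Fin d) ℂ) : Finset (Fin d) :=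
  univ.filter fun l => conjDiag K R l ≠ 0

theorem mem_diagSupport {K R : Matrix (Fin d) (Fin d) ℂ} {l : Fin d} :
    l ∈ diagSupport K R ↔ conjDiag K R l ≠ 0 := by
  simp [diagSupport]

theorem diagSupport_annihilate_ssubset {K R : Matrix (Fin d) (Fin d) ℂ} {p : Fin d × Fin d}
    (h : ¬ 0 ≤ conjDiag K R p.1 * conjDiag K R p.2) :
    diagSupport K (annihilate K R p) ⊂ diagSupport K R := by
  rw [annihilate, if_neg h]
  have h0 := conjDiag_mul_annihilating h
  have h1 : conjDiag K R p.1 ≠ 0 := fun h0 => h (by rw [h0, zero_mul])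
  have h2 : conjDiag K R p.2 ≠ 0 := fun h0 => h (by rw [h0, mul_zero])
  refine Finset.ssubset_iff_subset_ne.2 ⟨fun l hl => ?_, fun he => ?_⟩
  · rw [mem_diagSupport] at hl ⊢
    by_cases hl1 : l = p.1
    · rwa [hl1]
    by_cases hl2 : l = p.2
    · rwa [hl2]
    rw [conjDiag, Matrix.conjTranspose_mul] at hl
    rw [conjDiag, ← conj_twoLevel_apply_of_ne (Rᴴ * K * R) hl1 hl2
      (annihilatingSlope K R p.1 p.2)]
    simpa only [Matrix.mul_assoc] using hl
  · have := mem_diagSupport.2 h1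
    rw [← he, mem_diagSupport] at this
    exact this h0

theorem diagSupport_annihilate_subset (K R : Matrix (Fin d) (Fin d) ℂ) (p : Fin d × Fin d) :
    diagSupport K (annihilate K R p) ⊆ diagSupport K R := by
  by_cases h : 0 ≤ conjDiag K R p.1 * conjDiag K R p.2
  · rw [annihilate, if_pos h]
  · exact (diagSupport_annihilate_ssubset h).subset

theorem diagSupport_foldl_subset (K : Matrix (Fin d) (Fin d) ℂ) (l : List (Fin d × Fin d))
    (R : Matrix (Fin d) (Fin d) ℂ) :
    diagSupport K (l.foldl (annihilate K) R) ⊆ diagSupport K R := by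
  induction l generalizing R with
  | nil => exact subset_rfl
  | cons p l ih => exact (ih _).trans (diagSupport_annihilate_subset K R p)

theorem diagSupport_foldl_ssubset (K : Matrix (Fin d) (Fin d) ℂ) {l : List (Fin d × Fin d)}
    {R : Matrix (Fin d) (Fin d) ℂ} {p : Fin d × Fin d} (hp : p ∈ l)
    (h : ¬ 0 ≤ conjDiag K R p.1 * conjDiag K R p.2) :
    diagSupport K (l.foldl (annihilate K) R) ⊂ diagSupport K R := by
  induction l with
  | nil => simp at hp
  | cons q l ih =>
    by_cases hq : 0 ≤ conjDiag K R q.1 * conjDiag K R q.2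
    · rw [List.foldl_cons, annihilate, if_pos hq]
      rcases List.mem_cons.1 hp with rfl | hp
      · exact absurd hq h
      · exact ih hp
    · exact (diagSupport_foldl_subset K l _).trans_ssubset (diagSupport_annihilate_ssubset hq)

theorem annihilate_mem_unitaryGroup (K : Matrix (Fin d) (Fin d) ℂ)
    {R : Matrix (Fin d) (Fin d) ℂ} (hR : R ∈ Matrix.unitaryGroup (Fin d) ℂ) (p : Fin d × Fin d) :
    annihilate K R p ∈ Matrix.unitaryGroup (Fin d) ℂ := by
  rw [annihilate]
  split_ifs with h
  · exact hR
  · exact mul_mem hR (twoLevel_mem_unitaryGroup (ne_of_opposite h) _)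

theorem annihilateSweep_mem_unitaryGroup (K : Matrix (Fin d) (Fin d) ℂ)
    {R : Matrix (Fin d) (Fin d) ℂ} (hR : R ∈ Matrix.unitaryGroup (Fin d) ℂ) :
    annihilateSweep K R ∈ Matrix.unitaryGroup (Fin d) ℂ := by
  rw [annihilateSweep]
  generalize (Finset.univ : Finset (Fin d × Fin d)).toList = l
  induction l generalizing R with
  | nil => exact hR
  | cons p l ih => exact ih (annihilate_mem_unitaryGroup K hR p)

theorem iterate_annihilateSweep_mem_unitaryGroup (K : Matrix (Fin d) (Fin d) ℂ) (n : ℕ) :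
    (annihilateSweep K)^[n] 1 ∈ Matrix.unitaryGroup (Fin d) ℂ := by
  induction n with
  | zero => exact one_mem _
  | succ n ih =>
    rw [Function.iterate_succ_apply']
    exact annihilateSweep_mem_unitaryGroup K ih

theorem diagonalKiller_mem_unitaryGroup (K : Matrix (Fin d) (Fin d) ℂ) :
    diagonalKiller K ∈ Matrix.unitaryGroup (Fin d) ℂ :=
  iterate_annihilateSweep_mem_unitaryGroup K d

theorem trace_conj_unitary (K : Matrix (Fin d) (Fin d) ℂ) {R : Matrix (Fin d) (Fin d) ℂ}
    (hR : R ∈ Matrix.unitaryGroup (Fin d) ℂ) : (Rᴴ * K * R).trace = K.trace := by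
  rw [Matrix.trace_mul_comm, ← Matrix.mul_assoc, ← Matrix.star_eq_conjTranspose,
    Matrix.mem_unitaryGroup_iff.1 hR, Matrix.one_mul]

/-- The entries of a vanishing sum which are not all zero include two of opposite signs. -/
theorem exists_opposite {K R : Matrix (Fin d) (Fin d) ℂ} (hK : K.trace = 0)
    (hR : R ∈ Matrix.unitaryGroup (Fin d) ℂ) (h : (diagSupport K R).Nonempty) :
    ∃ p : Fin d × Fin d, ¬ 0 ≤ conjDiag K R p.1 * conjDiag K R p.2 := by
  have hsum : ∑ l, conjDiag K R l = 0 := by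
    have := congrArg Complex.im (trace_conj_unitary K hR)
    rw [hK, Matrix.trace, Complex.im_sum] at this
    exact this
  obtain ⟨l, hl⟩ := h
  rw [mem_diagSupport] at hl
  obtain ⟨j, -, hj⟩ := Finset.exists_pos_of_sum_zero_of_exists_nonzero _ hsum
    ⟨l, Finset.mem_univ _, hl⟩
  obtain ⟨k, -, hk⟩ := Finset.exists_pos_of_sum_zero_of_exists_nonzero (s := Finset.univ)
    (fun l => -conjDiag K R l) (by rw [Finset.sum_neg_distrib, hsum, neg_zero])
    ⟨l, Finset.mem_univ _, neg_ne_zero.2 hl⟩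
  exact ⟨(j, k), by nlinarith⟩

theorem card_diagSupport_iterate_le {K : Matrix (Fin d) (Fin d) ℂ} (hK : K.trace = 0) (n : ℕ) :
    (diagSupport K ((annihilateSweep K)^[n] 1)).card ≤ d - n := by
  induction n with
  | zero => simpa using Finset.card_le_univ (diagSupport K (1 : Matrix (Fin d) (Fin d) ℂ))
  | succ n ih =>
    rw [Function.iterate_succ_apply']
    have hU := iterate_annihilateSweep_mem_unitaryGroup K n
    generalize (annihilateSweep K)^[n] 1 = R at ih hU
    rcases (diagSupport K R).eq_empty_or_nonempty with h | h
    · have : diagSupport K (annihilateSweep K R) ⊆ ∅ :=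
        h ▸ diagSupport_foldl_subset K _ R
      rw [Finset.subset_empty.1 this]
      simp
    · obtain ⟨p, hp⟩ := exists_opposite hK hU h
      have : (diagSupport K (annihilateSweep K R)).card < (diagSupport K R).card :=
        Finset.card_lt_card (diagSupport_foldl_ssubset K
        (Finset.mem_toList.2 (Finset.mem_univ p)) hp)
      omega

/-- A traceless skew-Hermitian matrix is unitarily conjugate to one with zero diagonal. -/
theorem diag_conj_diagonalKiller {K : Matrix (Fin d) (Fin d) ℂ} (hK : K.trace = 0)
    (hskew : Kᴴ = -K) (l : Fin d) : ((diagonalKiller K)ᴴ * K * diagonalKiller K) l l = 0 := by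
  set R := diagonalKiller K with hR
  have h := card_diagSupport_iterate_le hK d
  rw [Nat.sub_self, Nat.le_zero, Finset.card_eq_zero] at h
  have him : conjDiag K R l = 0 := by
    by_contra hc
    have := mem_diagSupport.2 hc
    rw [hR, diagonalKiller, h] at this
    simp at this
  have hs : (Rᴴ * K * R)ᴴ = -(Rᴴ * K * R) := by
    rw [Matrix.conjTranspose_mul, Matrix.conjTranspose_mul, Matrix.conjTranspose_conjTranspose,
      hskew]
    simp [Matrix.mul_assoc]
  have hre := congrArg Complex.re (congrFun (congrFun hs l) l)
  simp only [Matrix.conjTranspose_apply, Matrix.neg_apply, RCLike.star_def, Complex.conj_re,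
    Complex.neg_re] at hre
  exact Complex.ext (by rw [Complex.zero_re]; linarith) him

section Computability

variable {K R : (ℕ → ℝ) → Matrix (Fin d) (Fin d) ℂ}

theorem isComputableM_annihilate (hK : IsComputableM K) (hR : IsComputableM R)
    (p : Fin d × Fin d) : IsComputableM fun r => annihilate (K r) (R r) p := by
  have hH : IsComputableM fun r => (R r)ᴴ * K r * R r := (hR.conjTranspose.mul hK).mul hR
  have hd : ∀ l, IsComputable fun r => conjDiag (K r) (R r) l := fun l => (hH l l).2
  have hb := ((hH p.1 p.2).add (hH p.2 p.1)).2
  have hs : IsComputable fun r => annihilatingSlope (K r) (R r) p.1 p.2 :=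
    (hb.add ((hb.mul hb).sub ((IsComputable.const 4).mul ((hd p.1).mul (hd p.2)))).sqrt).div
      ((IsComputable.const 2).mul (hd p.2))
  exact IsComputableM.ite (.const 0) ((hd p.1).mul (hd p.2)) hR
    (hR.mul (isComputableM_twoLevel _ _ (.ofReal hs)))

theorem isComputableM_annihilateSweep (hK : IsComputableM K) (hR : IsComputableM R) :
    IsComputableM fun r => annihilateSweep (K r) (R r) := by
  unfold annihilateSweep
  generalize (Finset.univ : Finset (Fin d × Fin d)).toList = l
  induction l generalizing R with
  | nil => exact hR
  | cons p l ih => exact ih (isComputableM_annihilate hK hR p)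

theorem isComputableM_diagonalKiller (hK : IsComputableM K) :
    IsComputableM fun r => diagonalKiller (K r) := by
  have h : ∀ n, IsComputableM fun r => (annihilateSweep (K r))^[n] 1 := by
    intro n
    induction n with
    | zero => exact .const 1
    | succ n ih =>
      simp only [Function.iterate_succ_apply']
      exact isComputableM_annihilateSweep hK ih
  exact h d

end Computability

/-! ### Unitary matrices near the identity as commutators -/

/-- The traceless skew-Hermitian part of `U`. -/
def skewPart (U : Matrix (Fin d) (Fin d) ℂ) : Matrix (Fin d) (Fin d) ℂ :=
  (1 / 2 : ℂ) • (U - Uᴴ) - (((1 / 2 : ℂ) • (U - Uᴴ)).trace / d) • (1 : Matrix (Fin d) (Fin d) ℂ)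

/-- The traceless skew-Hermitian part of `U` in a basis in which its diagonal vanishes. -/
def offDiagPart (U : Matrix (Fin d) (Fin d) ℂ) : Matrix (Fin d) (Fin d) ℂ :=
  (diagonalKiller (skewPart U))ᴴ * skewPart U * diagonalKiller (skewPart U)

/-- The order of magnitude of the two factors of the commutator: the square root of the size of
the matrix that is to be written as a commutator. -/
def commutatorScale (U : Matrix (Fin d) (Fin d) ℂ) : ℝ :=
  Real.sqrt (∑ i, ∑ j, ‖offDiagPart U i j‖)

/-- The matrix `X` with `[X, i s D] = K`, where `K = offDiagPart U`, `s = commutatorScale U` and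
`D` is the diagonal matrix with entries `0, 1, …, d - 1`. Where the denominator vanishes (on the
diagonal, and everywhere if `s = 0`), so does the numerator, and the entry is `0`. -/
def leftGenerator (U : Matrix (Fin d) (Fin d) ℂ) : Matrix (Fin d) (Fin d) ℂ :=
  Matrix.of fun j k => offDiagPart U j k /
    (Complex.I * commutatorScale U * (((k : ℕ) : ℂ) - ((j : ℕ) : ℂ)))

/-- The angles of the diagonal factor: equally spaced, and symmetric so that their sum is `0`. -/
def rightAngles (U : Matrix (Fin d) (Fin d) ℂ) (j : Fin d) : ℝ :=
  commutatorScale U * ((j : ℕ) - ((d : ℝ) - 1) / 2)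

/-- The pairs `j < k` of indices, in an arbitrary order: the order affects the product of small
rotations only to second order. -/
def increasingPairs (d : ℕ) : List (Fin d × Fin d) :=
  ((Finset.univ : Finset (Fin d × Fin d)).filter fun p => p.1 < p.2).toList

/-- The first factor of a group commutator that approximates `U`, in the basis of
`offDiagPart`. -/
def leftRotation (U : Matrix (Fin d) (Fin d) ℂ) : Matrix (Fin d) (Fin d) ℂ :=
  ((increasingPairs d).map fun p => twoLevel p.1 p.2 (leftGenerator U p.1 p.2)).prod

/-- The first factor of a group commutator that approximates `U`. -/
def leftFactor (U : Matrix (Fin d) (Fin d) ℂ) : Matrix (Fin d) (Fin d) ℂ :=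
  diagonalKiller (skewPart U) * leftRotation U * (diagonalKiller (skewPart U))ᴴ

/-- The second factor of a group commutator that approximates `U`. -/
def rightFactor (U : Matrix (Fin d) (Fin d) ℂ) : Matrix (Fin d) (Fin d) ℂ :=
  diagonalKiller (skewPart U) * phaseDiagonal (rightAngles U) * (diagonalKiller (skewPart U))ᴴ

theorem increasingPairs_ne : ∀ p ∈ increasingPairs d, p.1 ≠ p.2 := fun p hp => by
  simp only [increasingPairs, Finset.mem_toList, Finset.mem_filter] at hp
  exact hp.2.ne

theorem conj_mem_specialUnitaryGroup {R V : Matrix (Fin d) (Fin d) ℂ}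
    (hR : R ∈ Matrix.unitaryGroup (Fin d) ℂ) (hV : V ∈ Matrix.unitaryGroup (Fin d) ℂ)
    (hdet : V.det = 1) : R * V * Rᴴ ∈ Matrix.specialUnitaryGroup (Fin d) ℂ := by
  rw [Matrix.mem_specialUnitaryGroup_iff]
  refine ⟨mul_mem (mul_mem hR hV) (Unitary.star_mem hR), ?_⟩
  rw [Matrix.det_mul, Matrix.det_mul, hdet, mul_one, ← Matrix.det_mul,
    ← Matrix.star_eq_conjTranspose, Matrix.mem_unitaryGroup_iff.1 hR, Matrix.det_one]

theorem leftFactor_mem (U : Matrix (Fin d) (Fin d) ℂ) :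
    leftFactor U ∈ Matrix.specialUnitaryGroup (Fin d) ℂ :=
  conj_mem_specialUnitaryGroup (diagonalKiller_mem_unitaryGroup _)
    (prod_twoLevel_mem_unitaryGroup _ increasingPairs_ne fun p => leftGenerator U p.1 p.2)
    (det_prod_twoLevel _ increasingPairs_ne fun p => leftGenerator U p.1 p.2)

theorem rightFactor_mem (U : Matrix (Fin d) (Fin d) ℂ) :
    rightFactor U ∈ Matrix.specialUnitaryGroup (Fin d) ℂ := by
  refine conj_mem_specialUnitaryGroup (diagonalKiller_mem_unitaryGroup _)
    (phaseDiagonal_mem_unitaryGroup _) (det_phaseDiagonal fun j => ?_)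
  have h : ((j.rev : ℕ) : ℝ) = (d : ℝ) - 1 - (j : ℕ) := by
    have := Fin.val_rev j
    have h2 := j.isLt
    rw [this, Nat.cast_sub (by omega)]
    push_cast
    ring
  rw [rightAngles, rightAngles, h]
  ring

theorem conjTranspose_skewPart (U : Matrix (Fin d) (Fin d) ℂ) : (skewPart U)ᴴ = -skewPart U := by
  have h : ((1 / 2 : ℂ) • (U - Uᴴ))ᴴ = -((1 / 2 : ℂ) • (U - Uᴴ)) := by
    rw [Matrix.conjTranspose_smul, Matrix.conjTranspose_sub, Matrix.conjTranspose_conjTranspose,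
      ← smul_neg, neg_sub]
    simp
  have h2 := Matrix.trace_conjTranspose ((1 / 2 : ℂ) • (U - Uᴴ))
  rw [h, Matrix.trace_neg] at h2
  rw [skewPart, Matrix.conjTranspose_sub, h, Matrix.conjTranspose_smul, star_div₀, ← h2]
  simp only [star_natCast, Matrix.conjTranspose_one]
  module

theorem trace_skewPart (U : Matrix (Fin d) (Fin d) ℂ) : (skewPart U).trace = 0 := by
  rcases Nat.eq_zero_or_pos d with rfl | hd
  · simp [Matrix.trace]
  · have : (d : ℂ) ≠ 0 := by exact_mod_cast hd.ne'
    rw [skewPart, Matrix.trace_sub]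
    generalize (1 / 2 : ℂ) • (U - Uᴴ) = S
    rw [Matrix.trace_smul, Matrix.trace_one, Fintype.card_fin, smul_eq_mul,
      div_mul_cancel₀ _ this, sub_self]

theorem offDiagPart_apply_self (U : Matrix (Fin d) (Fin d) ℂ) (j : Fin d) :
    offDiagPart U j j = 0 :=
  diag_conj_diagonalKiller (trace_skewPart U) (conjTranspose_skewPart U) j

theorem conjTranspose_offDiagPart (U : Matrix (Fin d) (Fin d) ℂ) :
    (offDiagPart U)ᴴ = -offDiagPart U := by
  rw [offDiagPart, Matrix.conjTranspose_mul, Matrix.conjTranspose_mul,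
    Matrix.conjTranspose_conjTranspose, conjTranspose_skewPart]
  simp [Matrix.mul_assoc]

theorem commutatorScale_nonneg (U : Matrix (Fin d) (Fin d) ℂ) : 0 ≤ commutatorScale U :=
  Real.sqrt_nonneg _

theorem norm_offDiagPart_apply_le (U : Matrix (Fin d) (Fin d) ℂ) (j k : Fin d) :
    ‖offDiagPart U j k‖ ≤ commutatorScale U ^ 2 := by
  rw [commutatorScale, Real.sq_sqrt (by positivity)]
  exact (Finset.single_le_sum (f := fun k => ‖offDiagPart U j k‖)
    (fun _ _ => norm_nonneg _) (Finset.mem_univ k)).trans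
    (Finset.single_le_sum (f := fun j => ∑ k, ‖offDiagPart U j k‖)
    (fun _ _ => Finset.sum_nonneg fun _ _ => norm_nonneg _) (Finset.mem_univ j))

theorem norm_leftGenerator_apply_le (U : Matrix (Fin d) (Fin d) ℂ) (j k : Fin d) :
    ‖leftGenerator U j k‖ ≤ commutatorScale U := by
  have hs := commutatorScale_nonneg U
  rw [leftGenerator, Matrix.of_apply, norm_div, norm_mul, norm_mul, Complex.norm_I, one_mul,
    Complex.norm_real, Real.norm_of_nonneg hs]
  rcases eq_or_ne j k with rfl | hjk
  · simpa using hs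
  have h1 : 1 ≤ ‖((k : ℕ) : ℂ) - ((j : ℕ) : ℂ)‖ := by
    have : ((k : ℕ) : ℂ) - ((j : ℕ) : ℂ) = (((k : ℕ) - (j : ℕ) : ℤ) : ℂ) := by push_cast; rfl
    rw [this, Complex.norm_intCast]
    have h0 : ((k : ℕ) - (j : ℕ) : ℤ) ≠ 0 := by
      intro h
      exact hjk (Fin.ext (by omega))
    exact_mod_cast Int.one_le_abs h0
  refine div_le_of_le_mul₀ (by positivity) hs ((norm_offDiagPart_apply_le U j k).trans ?_)
  nlinarith [mul_nonneg hs hs]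

theorem leftGenerator_star (U : Matrix (Fin d) (Fin d) ℂ) (j k : Fin d) :
    star (leftGenerator U j k) = -leftGenerator U k j := by
  have h := congrFun (congrFun (conjTranspose_offDiagPart U) k) j
  rw [Matrix.conjTranspose_apply, Matrix.neg_apply] at h
  rw [leftGenerator, Matrix.of_apply, Matrix.of_apply, star_div₀, h]
  simp only [star_mul', star_sub, star_natCast, RCLike.star_def, Complex.conj_I,
    Complex.conj_ofReal]
  rw [← neg_div]
  congr 1
  ring

/-- A skew-Hermitian matrix with zero diagonal is a sum of infinitesimal rotations in the coordinate
planes. -/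
theorem sum_twoLevelTangent_leftGenerator (U : Matrix (Fin d) (Fin d) ℂ) :
    ((increasingPairs d).map fun p =>
      twoLevelTangent p.1 p.2 (leftGenerator U p.1 p.2)).sum = leftGenerator U := by
  rw [increasingPairs, Finset.sum_map_toList]
  have hdiag : ∀ j, leftGenerator U j j = 0 := fun j => by
    rw [leftGenerator, Matrix.of_apply, offDiagPart_apply_self, zero_div]
  simp only [twoLevelTangent, leftGenerator_star]
  ext a b
  rw [Matrix.sum_apply]
  rcases lt_trichotomy a b with h | rfl | h
  · rw [Finset.sum_eq_single (a, b)]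
    · simp [h.ne, h.ne']
    · rintro ⟨x, y⟩ hp hne
      simp only [Finset.mem_filter, Finset.mem_univ, true_and] at hp
      have h1 : ¬(x = a ∧ y = b) := fun h => hne (by rw [h.1, h.2])
      have h2 : ¬(y = a ∧ x = b) := fun hh => by
        rw [hh.1, hh.2] at hp; exact absurd hp h.not_gt
      simp [h1, h2]
    · intro hp; simp [h] at hp
  · rw [hdiag]
    refine Finset.sum_eq_zero ?_
    rintro ⟨x, y⟩ hp
    simp only [Finset.mem_filter, Finset.mem_univ, true_and] at hp
    have h1 : ¬(x = a ∧ y = a) := fun h => by rw [h.1, h.2] at hp; exact lt_irrefl _ hp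
    have h2 : ¬(y = a ∧ x = a) := fun h => h1 h.symm
    simp [h1, h2]
  · rw [Finset.sum_eq_single (b, a)]
    · simp [h.ne, h.ne']
    · rintro ⟨x, y⟩ hp hne
      simp only [Finset.mem_filter, Finset.mem_univ, true_and] at hp
      have h1 : ¬(y = a ∧ x = b) := fun h => hne (by rw [h.1, h.2])
      have h2 : ¬(x = a ∧ y = b) := fun hh => by
        rw [hh.1, hh.2] at hp; exact absurd hp h.not_gt
      simp [h1, h2]
    · intro hp; simp [h] at hp

/-- The angles differ from the multiples `0, s, 2 s, …` of the scale by a constant, which does not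
change the Lie bracket. -/
theorem leftGenerator_commutator (U : Matrix (Fin d) (Fin d) ℂ) :
    leftGenerator U * (Matrix.diagonal fun j => Complex.I * rightAngles U j) -
      (Matrix.diagonal fun j => Complex.I * rightAngles U j) * leftGenerator U =
    offDiagPart U := by
  ext j k
  rw [Matrix.sub_apply, Matrix.mul_diagonal, Matrix.diagonal_mul]
  rcases eq_or_ne j k with rfl | hjk
  · rw [offDiagPart_apply_self]
    ring
  rw [leftGenerator, Matrix.of_apply, rightAngles, rightAngles]
  rcases eq_or_ne (commutatorScale U) 0 with hs | hs
  · have := norm_offDiagPart_apply_le U j k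
    rw [hs] at this
    have h0 : offDiagPart U j k = 0 := by
      rw [← norm_le_zero_iff]
      simpa using this
    rw [h0]
    ring
  · have h1 : (commutatorScale U : ℂ) ≠ 0 := by exact_mod_cast hs
    have h2 : ((k : ℕ) : ℂ) - ((j : ℕ) : ℂ) ≠ 0 := by
      rw [sub_ne_zero]
      intro h
      exact hjk (Fin.ext (by exact_mod_cast h.symm))
    have h3 := Complex.I_ne_zero
    push_cast
    field_simp
    ring

/-- The group commutator of two unitary matrices near the identity, tangent to `X` and `Y`, is
the Lie bracket of `X` and `Y` up to third order. -/
theorem norm_commutator_sub_le {V W X Y : Matrix (Fin d) (Fin d) ℂ}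
    (hV : V ∈ Matrix.unitaryGroup (Fin d) ℂ) (hW : W ∈ Matrix.unitaryGroup (Fin d) ℂ)
    {C s : ℝ} (hV1 : ‖V - 1‖ ≤ C * s) (hW1 : ‖W - 1‖ ≤ C * s)
    (hVX : ‖V - 1 - X‖ ≤ C * s ^ 2) (hWY : ‖W - 1 - Y‖ ≤ C * s ^ 2) (hX : ‖X‖ ≤ C * s)
    (hY : ‖Y‖ ≤ C * s) :
    ‖V * W * Vᴴ * Wᴴ - 1 - (X * Y - Y * X)‖ ≤ (4 * C ^ 2 + 4 * C ^ 3) * s ^ 3 := by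
  have hVV : V * Vᴴ = 1 := Matrix.mem_unitaryGroup_iff.1 hV
  have hWW : W * Wᴴ = 1 := Matrix.mem_unitaryGroup_iff.1 hW
  have hVh : Vᴴ ∈ Matrix.unitaryGroup (Fin d) ℂ := Unitary.star_mem hV
  have hWh : Wᴴ ∈ Matrix.unitaryGroup (Fin d) ℂ := Unitary.star_mem hW
  have hWVVW : W * V * Vᴴ * Wᴴ = 1 := by
    rw [Matrix.mul_assoc W, hVV, Matrix.mul_one, hWW]
  have e : V * W * Vᴴ * Wᴴ - 1 - (X * Y - Y * X) =
      ((V - 1 - X) * (W - 1) + X * (W - 1 - Y) - ((W - 1 - Y) * (V - 1) + Y * (V - 1 - X)))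
        * (Vᴴ * Wᴴ) + (X * Y - Y * X) * (Vᴴ * Wᴴ - 1) := by
    have e1 : (V - 1 - X) * (W - 1) + X * (W - 1 - Y) - ((W - 1 - Y) * (V - 1) + Y * (V - 1 - X))
        = V * W - W * V - (X * Y - Y * X) := by noncomm_ring
    rw [e1, Matrix.sub_mul, Matrix.sub_mul, Matrix.mul_sub, Matrix.mul_one]
    rw [show W * V * (Vᴴ * Wᴴ) = 1 by rw [← hWVVW]; simp only [Matrix.mul_assoc]]
    simp only [Matrix.mul_assoc]
    abel
  have hVW : ‖Vᴴ * Wᴴ - 1‖ ≤ 2 * (C * s) := by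
    have e2 : Vᴴ * Wᴴ - 1 = (Vᴴ - 1) * Wᴴ + (Wᴴ - 1) := by noncomm_ring
    have h1 : ‖Vᴴ - 1‖ = ‖V - 1‖ := by
      rw [← Matrix.l2_opNorm_conjTranspose (V - 1), Matrix.conjTranspose_sub,
        Matrix.conjTranspose_one]
    have h2 : ‖Wᴴ - 1‖ = ‖W - 1‖ := by
      rw [← Matrix.l2_opNorm_conjTranspose (W - 1), Matrix.conjTranspose_sub,
        Matrix.conjTranspose_one]
    rw [e2]
    refine (norm_add_le _ _).trans ?_
    rw [norm_mul_unitary _ hWh, h1, h2]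
    linarith
  have m : ∀ {A B : Matrix (Fin d) (Fin d) ℂ} {a b : ℝ}, ‖A‖ ≤ a → ‖B‖ ≤ b → ‖A * B‖ ≤ a * b :=
    fun {A B a b} ha hb => (norm_mul_le A B).trans
      (mul_le_mul ha hb (norm_nonneg _) ((norm_nonneg _).trans ha))
  rw [e]
  have h1 := m hVX hW1
  have h2 := m hX hWY
  have h3 := m hWY hV1
  have h4 := m hY hVX
  have h5 : ‖X * Y - Y * X‖ ≤ C * s * (C * s) + C * s * (C * s) :=
    (norm_sub_le _ _).trans (add_le_add (m hX hY) (m hY hX))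
  have h6 := m h5 hVW
  refine (norm_add_le _ _).trans ?_
  rw [norm_mul_unitary _ (mul_mem hVh hWh)]
  have h7 := (norm_sub_le _ _).trans (add_le_add ((norm_add_le _ _).trans (add_le_add h1 h2))
    ((norm_add_le _ _).trans (add_le_add h3 h4)))
  refine (add_le_add h7 h6).trans (le_of_eq ?_)
  ring

theorem norm_trace_le (A : Matrix (Fin d) (Fin d) ℂ) : ‖A.trace‖ ≤ d * ‖A‖ := by
  simpa [Matrix.trace] using norm_sum_le_of_le Finset.univ fun i _ => norm_entry_le A i i

theorem norm_div_natCast_le (z : ℂ) (n : ℕ) : ‖z / n‖ ≤ ‖z‖ := by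
  rcases Nat.eq_zero_or_pos n with rfl | hn
  · simp
  · rw [norm_div, Complex.norm_natCast]
    exact div_le_self (norm_nonneg _) (by exact_mod_cast hn)

theorem norm_skewPart_le {U : Matrix (Fin d) (Fin d) ℂ} : ‖skewPart U‖ ≤ (1 + d) * ‖U - 1‖ := by
  have h1 : ‖(1 / 2 : ℂ) • (U - Uᴴ)‖ ≤ ‖U - 1‖ := by
    have e : U - Uᴴ = (U - 1) - (U - 1)ᴴ := by
      rw [Matrix.conjTranspose_sub, Matrix.conjTranspose_one]; abel
    have := norm_sub_le (U - 1) (U - 1)ᴴ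
    rw [Matrix.l2_opNorm_conjTranspose, ← e] at this
    rw [norm_smul]
    norm_num
    linarith
  rw [skewPart]
  generalize (1 / 2 : ℂ) • (U - Uᴴ) = S at h1
  refine (norm_sub_le _ _).trans ?_
  rw [norm_smul]
  have h4 := mul_le_mul_of_nonneg_left h1 (Nat.cast_nonneg (α := ℝ) d)
  have h5 := mul_le_mul ((norm_div_natCast_le S.trace d).trans ((norm_trace_le S).trans h4))
    (norm_one_le (d := d)) (norm_nonneg _) (by positivity)
  linarith

/-- A special unitary matrix `U` near the identity is `1 + skewPart U` up to second order. -/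
theorem exists_norm_sub_skewPart_le (d : ℕ) :
    ∃ C : ℝ, 0 ≤ C ∧ ∀ U ∈ Matrix.specialUnitaryGroup (Fin d) ℂ, ‖U - 1‖ ≤ 1 →
      ‖U - 1 - skewPart U‖ ≤ C * ‖U - 1‖ ^ 2 := by
  obtain ⟨C, hC, h⟩ := exists_norm_det_one_add_sub_le d
  refine ⟨1 + d + C, by positivity, fun U hU hU1 => ?_⟩
  obtain ⟨hU2, hdet⟩ := Matrix.mem_specialUnitaryGroup_iff.1 hU
  have hUU : U * Uᴴ = 1 := Matrix.mem_unitaryGroup_iff.1 hU2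
  obtain ⟨A, rfl⟩ : ∃ A, U = 1 + A := ⟨U - 1, by abel⟩
  rw [add_sub_cancel_left] at hU1 ⊢
  have h1 := h A hU1
  rw [hdet, sub_self, zero_sub, norm_neg] at h1
  rw [Matrix.conjTranspose_add, Matrix.conjTranspose_one] at hUU
  have h2 : A + Aᴴ = -(A * Aᴴ) := by
    have e : (1 + A) * (1 + Aᴴ) = 1 + (A + Aᴴ + A * Aᴴ) := by noncomm_ring
    rw [e] at hUU
    exact eq_neg_of_add_eq_zero_left (by simpa using hUU)
  have h3 : ‖(1 / 2 : ℂ) • (A * Aᴴ)‖ ≤ ‖A‖ ^ 2 := by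
    rw [norm_smul]
    have := norm_mul_le A Aᴴ
    rw [Matrix.l2_opNorm_conjTranspose] at this
    norm_num
    nlinarith [sq_nonneg ‖A‖]
  have e1 : (1 / 2 : ℂ) • (1 + A - (1 + A)ᴴ) = A + (1 / 2 : ℂ) • (A * Aᴴ) := by
    rw [Matrix.conjTranspose_add, Matrix.conjTranspose_one]
    have h4 : A * Aᴴ = -A - Aᴴ := by rw [← neg_add', h2, neg_neg]
    rw [h4]
    module
  rw [skewPart, e1]
  generalize (1 / 2 : ℂ) • (A * Aᴴ) = B at h3
  have e2 : A - (A + B - ((A + B).trace / d) • (1 : Matrix (Fin d) (Fin d) ℂ)) =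
      -B + ((A + B).trace / d) • (1 : Matrix (Fin d) (Fin d) ℂ) := by abel
  rw [e2]
  refine (norm_add_le _ _).trans ?_
  rw [norm_neg, norm_smul]
  have h5 : ‖(A + B).trace‖ ≤ C * ‖A‖ ^ 2 + d * ‖A‖ ^ 2 := by
    rw [Matrix.trace_add]
    refine (norm_add_le _ _).trans (add_le_add h1 ((norm_trace_le B).trans ?_))
    exact mul_le_mul_of_nonneg_left h3 (Nat.cast_nonneg _)
  have h6 := mul_le_mul ((norm_div_natCast_le _ d).trans h5) (norm_one_le (d := d))
    (norm_nonneg _) (by positivity)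
  linarith

theorem commutatorScale_le {U : Matrix (Fin d) (Fin d) ℂ} {σ : ℝ} (hσ : 0 ≤ σ)
    (hU : ‖U - 1‖ ≤ σ ^ 2) : commutatorScale U ≤ d * (1 + d) * σ := by
  refine Real.sqrt_le_iff.2 ⟨by positivity, ?_⟩
  have hn : ‖offDiagPart U‖ ≤ (1 + d) * σ ^ 2 := by
    have hR := diagonalKiller_mem_unitaryGroup (skewPart U)
    rw [offDiagPart, norm_mul_unitary _ hR, ← Matrix.star_eq_conjTranspose,
      norm_unitary_mul (Unitary.star_mem hR)]
    exact norm_skewPart_le.trans (mul_le_mul_of_nonneg_left hU (by positivity))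
  have h : ∑ i, ∑ j, ‖offDiagPart U i j‖ ≤ ∑ _i : Fin d, ∑ _j : Fin d, (1 + d) * σ ^ 2 :=
    Finset.sum_le_sum fun i _ => Finset.sum_le_sum fun j _ => (norm_entry_le _ _ _).trans hn
  refine h.trans ?_
  simp only [Finset.sum_const, Finset.card_univ, Fintype.card_fin, nsmul_eq_mul]
  have h0 : (0 : ℝ) ≤ d := Nat.cast_nonneg _
  have : 0 ≤ (d : ℝ) ^ 3 * (1 + d) * σ ^ 2 := by positivity
  nlinarith

/-- **Balanced group commutators.** A special unitary matrix at distance `σ²` from the identity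
is, up to an error of order `σ³`, the group commutator of two special unitary matrices at distance
of order `σ` from the identity. -/
theorem exists_balanced_commutator (d : ℕ) :
    ∃ C : ℝ, 0 ≤ C ∧ ∀ U ∈ Matrix.specialUnitaryGroup (Fin d) ℂ, ∀ σ : ℝ, 0 ≤ σ → σ ≤ 1 →
      ‖U - 1‖ ≤ σ ^ 2 → ‖leftFactor U - 1‖ ≤ C * σ ∧ ‖rightFactor U - 1‖ ≤ C * σ ∧
      ‖U - leftFactor U * rightFactor U * (leftFactor U)ᴴ * (rightFactor U)ᴴ‖ ≤ C * σ ^ 3 := by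
  obtain ⟨C₁, hC₁, h₁⟩ := exists_norm_prod_twoLevel_le (increasingPairs d) increasingPairs_ne
  obtain ⟨C₂, hC₂, h₂⟩ := exists_norm_sub_skewPart_le d
  -- `C` bounds all constants of the approximations in terms of `s = commutatorScale U`
  set C : ℝ := C₁ + 3 * d + 2 * d ^ 2 + d * d with hC
  set D : ℝ := d * (1 + d) with hD
  have hC0 : 0 ≤ C := by positivity
  have hD0 : 0 ≤ D := by positivity
  have hd0 : (0 : ℝ) ≤ d := Nat.cast_nonneg _
  have hCa : C₁ ≤ C := by nlinarith
  have hCb : 3 * (d : ℝ) ≤ C := by nlinarith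
  have hCc : 2 * (d : ℝ) ^ 2 ≤ C := by nlinarith
  have hCd : d * d ≤ C := by nlinarith
  clear_value C
  refine ⟨C * D + (4 * C ^ 2 + 4 * C ^ 3) * D ^ 3 + C₂, by positivity,
    fun U hU σ hσ hσ1 hUσ => ?_⟩
  set s := commutatorScale U with hs
  have hs0 : 0 ≤ s := commutatorScale_nonneg U
  have hsσ : s ≤ D * σ := commutatorScale_le hσ hUσ
  clear_value D
  set R := diagonalKiller (skewPart U) with hRdef
  have hR : R ∈ Matrix.unitaryGroup (Fin d) ℂ := diagonalKiller_mem_unitaryGroup _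
  have hRR : R * Rᴴ = 1 := Matrix.mem_unitaryGroup_iff.1 hR
  have hRR' : Rᴴ * R = 1 := Matrix.mem_unitaryGroup_iff'.1 hR
  set V := leftRotation U with hVdef
  set W := phaseDiagonal (rightAngles U) with hWdef
  set X := leftGenerator U
  set Y : Matrix (Fin d) (Fin d) ℂ :=
    Matrix.diagonal fun j => Complex.I * rightAngles U j with hYdef
  obtain ⟨hV1, hV2⟩ := h₁ (fun p => leftGenerator U p.1 p.2) s
    fun p => norm_leftGenerator_apply_le U p.1 p.2
  rw [sum_twoLevelTangent_leftGenerator] at hV2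
  have hang : ∀ j, |rightAngles U j| ≤ d * s := fun j => by
    rw [rightAngles, abs_mul, abs_of_nonneg hs0, mul_comm]
    refine mul_le_mul_of_nonneg_right ?_ hs0
    have h1 : ((j : ℕ) : ℝ) + 1 ≤ d := by exact_mod_cast j.isLt
    have h2 : (0 : ℝ) ≤ (j : ℕ) := Nat.cast_nonneg _
    rw [abs_le]
    constructor <;> linarith
  obtain ⟨hW1, hW2⟩ := norm_phaseDiagonal_le (x := rightAngles U) (s := d * s) (by positivity) hang
  have hX : ‖X‖ ≤ d * d * s := by
    refine (norm_le_sum_entries _).trans ?_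
    have h : ∑ i, ∑ j, ‖X i j‖ ≤ ∑ _i : Fin d, ∑ _j : Fin d, s :=
      Finset.sum_le_sum fun i _ => Finset.sum_le_sum fun j _ => norm_leftGenerator_apply_le U i j
    refine h.trans (le_of_eq ?_)
    simp only [Finset.sum_const, Finset.card_univ, Fintype.card_fin, nsmul_eq_mul]
    ring
  have hY : ‖Y‖ ≤ d * s := by
    rw [hYdef, Matrix.l2_opNorm_diagonal, pi_norm_le_iff_of_nonneg (by positivity)]
    intro j
    rw [norm_mul, Complex.norm_I, one_mul, Complex.norm_real]
    exact hang j
  have hVC : ‖V - 1‖ ≤ C * s := hV1.trans (mul_le_mul_of_nonneg_right hCa hs0)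
  have hWC : ‖W - 1‖ ≤ C * s := hW1.trans (by
    rw [← mul_assoc]; exact mul_le_mul_of_nonneg_right hCb hs0)
  have hVU : V ∈ Matrix.unitaryGroup (Fin d) ℂ :=
    prod_twoLevel_mem_unitaryGroup _ increasingPairs_ne fun p => leftGenerator U p.1 p.2
  have hWU : W ∈ Matrix.unitaryGroup (Fin d) ℂ := phaseDiagonal_mem_unitaryGroup _
  have hcomm := norm_commutator_sub_le hVU hWU hVC hWC
    (hV2.trans (mul_le_mul_of_nonneg_right hCa (sq_nonneg s)))
    (hW2.trans (by
      rw [mul_pow, ← mul_assoc]; exact mul_le_mul_of_nonneg_right hCc (sq_nonneg s)))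
    (hX.trans (mul_le_mul_of_nonneg_right hCd hs0))
    (hY.trans (mul_le_mul_of_nonneg_right (by linarith) hs0))
  rw [leftGenerator_commutator] at hcomm
  have hCs : C * s ≤ (C * D + (4 * C ^ 2 + 4 * C ^ 3) * D ^ 3 + C₂) * σ := by
    have h1 := mul_le_mul_of_nonneg_left hsσ hC0
    have h2 : 0 ≤ ((4 * C ^ 2 + 4 * C ^ 3) * D ^ 3 + C₂) * σ := by positivity
    nlinarith
  have conj_sub_one : ∀ A : Matrix (Fin d) (Fin d) ℂ, R * A * Rᴴ - 1 = R * (A - 1) * Rᴴ := by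
    intro A
    rw [Matrix.mul_sub, Matrix.sub_mul, Matrix.mul_one, hRR]
  refine ⟨?_, ?_, ?_⟩
  · rw [leftFactor, conj_sub_one, norm_conj_unitary hR]
    exact hVC.trans hCs
  · rw [rightFactor, conj_sub_one, norm_conj_unitary hR]
    exact hWC.trans hCs
  · have hK : R * offDiagPart U * Rᴴ = skewPart U := by
      rw [offDiagPart, ← hRdef]
      calc R * (Rᴴ * skewPart U * R) * Rᴴ = (R * Rᴴ) * skewPart U * (R * Rᴴ) := by
            simp only [Matrix.mul_assoc]
        _ = _ := by rw [hRR, Matrix.one_mul, Matrix.mul_one]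
    have hc : leftFactor U * rightFactor U * (leftFactor U)ᴴ * (rightFactor U)ᴴ =
        R * (V * W * Vᴴ * Wᴴ) * Rᴴ := by
      have hm : ∀ A B : Matrix (Fin d) (Fin d) ℂ,
          R * A * Rᴴ * (R * B * Rᴴ) = R * (A * B) * Rᴴ := by
        intro A B
        calc R * A * Rᴴ * (R * B * Rᴴ) = R * A * (Rᴴ * R) * B * Rᴴ := by
              simp only [Matrix.mul_assoc]
          _ = _ := by rw [hRR', Matrix.mul_one]; simp only [Matrix.mul_assoc]
      have ht : ∀ A : Matrix (Fin d) (Fin d) ℂ, (R * A * Rᴴ)ᴴ = R * Aᴴ * Rᴴ := by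
        intro A
        simp [Matrix.conjTranspose_mul, Matrix.mul_assoc]
      rw [leftFactor, rightFactor, ← hRdef, ← hVdef, ← hWdef, ht, ht, hm, hm, hm]
    have e : U - R * (V * W * Vᴴ * Wᴴ) * Rᴴ = (U - 1 - skewPart U) -
        R * (V * W * Vᴴ * Wᴴ - 1 - offDiagPart U) * Rᴴ := by
      rw [Matrix.mul_sub, Matrix.sub_mul, hK, ← conj_sub_one]
      abel
    rw [hc, e]
    refine (norm_sub_le _ _).trans ?_
    rw [norm_conj_unitary hR]
    have hσ2 : σ ^ 2 ≤ 1 := pow_le_one₀ hσ hσ1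
    have h3 := h₂ U hU (hUσ.trans hσ2)
    have h4 : ‖U - 1‖ ^ 2 ≤ σ ^ 3 := by
      have h5 := pow_le_pow_left₀ (norm_nonneg _) hUσ 2
      have h6 : (0:ℝ) ≤ σ ^ 3 := by positivity
      nlinarith
    have h5 : s ^ 3 ≤ D ^ 3 * σ ^ 3 := by
      rw [← mul_pow]; exact pow_le_pow_left₀ hs0 hsσ 3
    have h6 := mul_le_mul_of_nonneg_left h4 hC₂
    have h7 := mul_le_mul_of_nonneg_left h5 (show 0 ≤ 4 * C ^ 2 + 4 * C ^ 3 by positivity)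
    have h8 : 0 ≤ C * D * σ ^ 3 := by positivity
    calc _ ≤ C₂ * σ ^ 3 + (4 * C ^ 2 + 4 * C ^ 3) * (D ^ 3 * σ ^ 3) :=
          add_le_add (h3.trans h6) (hcomm.trans h7)
      _ ≤ C * D * σ ^ 3 + (C₂ * σ ^ 3 + (4 * C ^ 2 + 4 * C ^ 3) * (D ^ 3 * σ ^ 3)) :=
          le_add_of_nonneg_left h8
      _ = _ := by ring

section Computability

variable {U : (ℕ → ℝ) → Matrix (Fin d) (Fin d) ℂ}

theorem isComputableM_skewPart (hU : IsComputableM U) :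
    IsComputableM fun r => skewPart (U r) := by
  have h : IsComputableM fun r => (1 / 2 : ℂ) • (U r - (U r)ᴴ) :=
    (hU.sub hU.conjTranspose).smul (.const _)
  have ht : IsComputableC fun r => ((1 / 2 : ℂ) • (U r - (U r)ᴴ)).trace / d := by
    simp only [div_eq_mul_inv]
    exact (IsComputableC.sum _ fun i => h i i).mul (.const _)
  exact h.sub (IsComputableM.smul ht (.const 1))

theorem isComputableM_offDiagPart (hU : IsComputableM U) :
    IsComputableM fun r => offDiagPart (U r) := by
  have h := isComputableM_skewPart hU
  have hR := isComputableM_diagonalKiller h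
  exact (hR.conjTranspose.mul h).mul hR

theorem isComputable_commutatorScale (hU : IsComputableM U) :
    IsComputable fun r => commutatorScale (U r) :=
  (IsComputable.sum _ fun i => IsComputable.sum _ fun j =>
    (isComputableM_offDiagPart hU i j).norm).sqrt

theorem isComputableM_leftGenerator (hU : IsComputableM U) :
    IsComputableM fun r => leftGenerator (U r) := fun j k => by
  have h := isComputableM_offDiagPart hU j k
  have hs := isComputable_commutatorScale hU
  -- dividing by the imaginary number `i s (k - j)` amounts to real divisions
  have e : ∀ r, leftGenerator (U r) j k = ((1 / (commutatorScale (U r) * ((k : ℕ) - (j : ℕ))) : ℝ)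
      : ℂ) * (-Complex.I * offDiagPart (U r) j k) := by
    intro r
    rw [leftGenerator, Matrix.of_apply, div_eq_mul_inv, mul_assoc Complex.I, mul_inv,
      Complex.inv_I]
    push_cast
    ring
  simp only [e]
  exact (IsComputableC.ofReal ((IsComputable.const 1).div (hs.mul (.const _)))).mul
    ((IsComputableC.const _).mul h)

theorem isComputableM_leftFactor (hU : IsComputableM U) :
    IsComputableM fun r => leftFactor (U r) := by
  have hR := isComputableM_diagonalKiller (isComputableM_skewPart hU)
  exact (hR.mul (IsComputableM.listProd _ fun p : Fin d × Fin d =>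
    isComputableM_twoLevel p.1 p.2 (isComputableM_leftGenerator hU p.1 p.2))).mul
      hR.conjTranspose

theorem isComputableM_rightFactor (hU : IsComputableM U) :
    IsComputableM fun r => rightFactor (U r) := by
  have hR := isComputableM_diagonalKiller (isComputableM_skewPart hU)
  have hx : ∀ j, IsComputable fun r => rightAngles (U r) j := fun j =>
    (isComputable_commutatorScale hU).mul (.const _)
  have hW : IsComputableM fun r => phaseDiagonal (rightAngles (U r)) := by
    intro i j
    by_cases h : i = j
    · subst h
      simp only [phaseDiagonal, Matrix.diagonal_apply_eq]
      exact (IsComputableC.ofReal (isComputable_rotScale (.ofReal (hx i)))).mul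
        ((IsComputableC.const 1).add ((IsComputableC.const _).mul (.ofReal (hx i))))
    · simp only [phaseDiagonal, Matrix.diagonal_apply_ne _ h]
      exact .const 0
  exact (hR.mul hW).mul hR.conjTranspose

end Computability

/-! ### Finite nets of words -/

/-- The formal inverse of a word. -/
def invWord (w : List (SU d)) : List (SU d) := (w.map fun g => g⁻¹).reverse

theorem prod_invWord (w : List (SU d)) : (invWord w).prod = w.prod⁻¹ :=
  (List.prod_inv_reverse w).symm

theorem invWord_append (v w : List (SU d)) : invWord (v ++ w) = invWord w ++ invWord v := by
  simp [invWord]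

theorem invWord_invWord (w : List (SU d)) : invWord (invWord w) = w := by
  simp [invWord]

theorem length_invWord (w : List (SU d)) : (invWord w).length = w.length := by
  simp [invWord]

theorem invWord_mem {G : Finset (SU d)} (hG : IsInstructionSet G) {w : List (SU d)}
    (hw : ∀ g ∈ w, g ∈ G) : ∀ g ∈ invWord w, g ∈ G := by
  intro g hg
  simp only [invWord, List.mem_reverse, List.mem_map] at hg
  obtain ⟨a, ha, rfl⟩ := hg
  exact hG.inv_mem a (hw a ha)

instance : CompactSpace (SU d) := by
  have h : IsCompact ((Matrix.specialUnitaryGroup (Fin d) ℂ : Submonoid _) :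
      Set (Matrix (Fin d) (Fin d) ℂ)) := by
    have : ProperSpace (Matrix (Fin d) (Fin d) ℂ) := FiniteDimensional.proper ℂ _
    refine Metric.isCompact_of_isClosed_isBounded ?_ ?_
    · have e : ((Matrix.specialUnitaryGroup (Fin d) ℂ : Submonoid _) :
          Set (Matrix (Fin d) (Fin d) ℂ)) = {A | A * star A = 1} ∩ {A | A.det = 1} := by
        ext A
        rw [SetLike.mem_coe, Matrix.mem_specialUnitaryGroup_iff, Matrix.mem_unitaryGroup_iff]
        rfl
      rw [e]
      exact (isClosed_eq (by fun_prop) continuous_const).inter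
        (isClosed_eq (Continuous.matrix_det continuous_id) continuous_const)
    · refine (isBounded_iff_forall_norm_le).2 ⟨1, fun A hA => ?_⟩
      exact norm_unitary_le (Matrix.mem_specialUnitaryGroup_iff.1 hA).1
  exact isCompact_iff_compactSpace.1 h

theorem exists_word_of_mem_closure {G : Finset (SU d)} (hG : IsInstructionSet G) {S : SU d}
    (hS : S ∈ Subgroup.closure (G : Set (SU d))) :
    ∃ w : List (SU d), (∀ g ∈ w, g ∈ G) ∧ w.prod = S := by
  induction hS using Subgroup.closure_induction with
  | mem x hx => exact ⟨[x], by simpa using hx, by simp⟩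
  | one => exact ⟨[], by simp, rfl⟩
  | mul x y _ _ hx hy =>
    obtain ⟨v, hv, rfl⟩ := hx
    obtain ⟨w, hw, rfl⟩ := hy
    refine ⟨v ++ w, fun g hg => ?_, by simp⟩
    rcases List.mem_append.1 hg with h | h
    · exact hv g h
    · exact hw g h
  | inv x _ hx =>
    obtain ⟨v, hv, rfl⟩ := hx
    exact ⟨invWord v, invWord_mem hG hv, prod_invWord v⟩

theorem isOpen_setOf_norm_sub_lt (S : SU d) (δ : ℝ) :
    IsOpen {U : SU d | ‖(U : Matrix (Fin d) (Fin d) ℂ) - S‖ < δ} :=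
  isOpen_lt ((continuous_subtype_val.sub continuous_const).norm) continuous_const

theorem exists_word_near {G : Finset (SU d)} (hG : IsInstructionSet G) {δ : ℝ} (hδ : 0 < δ)
    (U : SU d) : ∃ w : List (SU d), (∀ g ∈ w, g ∈ G) ∧
      ‖(U : Matrix (Fin d) (Fin d) ℂ) - (w.prod : SU d)‖ < δ := by
  obtain ⟨S, hS, hUS⟩ := hG.dense.inter_open_nonempty _ (isOpen_setOf_norm_sub_lt U δ)
    ⟨U, by simpa using hδ⟩
  obtain ⟨w, hw, rfl⟩ := exists_word_of_mem_closure hG hUS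
  exact ⟨w, hw, by rw [norm_sub_rev]; exact hS⟩

/-- By compactness, finitely many words over an instruction set suffice for approximations of a
fixed accuracy. -/
theorem exists_net {G : Finset (SU d)} (hG : IsInstructionSet G) {δ : ℝ} (hδ : 0 < δ) :
    ∃ l : List (List (SU d)), (∀ w ∈ l, ∀ g ∈ w, g ∈ G) ∧
      ∀ U : SU d, ∃ w ∈ l, ‖(U : Matrix (Fin d) (Fin d) ℂ) - (w.prod : SU d)‖ < δ := by
  choose f hfG hf using exists_word_near hG hδ
  obtain ⟨F, hF⟩ := isCompact_univ.elim_finite_subcover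
    (fun S : SU d => {U : SU d | ‖(U : Matrix (Fin d) (Fin d) ℂ) - ((f S).prod : SU d)‖ < δ})
    (fun S => isOpen_setOf_norm_sub_lt _ δ) (fun U _ => Set.mem_iUnion.2 ⟨U, hf U⟩)
  refine ⟨F.toList.map f, fun w hw => ?_, fun U => ?_⟩
  · obtain ⟨S, -, rfl⟩ := List.mem_map.1 hw
    exact hfG S
  · obtain ⟨S, hS⟩ := Set.mem_iUnion.1 (hF (Set.mem_univ U))
    obtain ⟨hSF, hS⟩ := Set.mem_iUnion.1 hS
    exact ⟨f S, List.mem_map.2 ⟨S, Finset.mem_toList.2 hSF, rfl⟩, hS⟩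

/-! ### One step of the recursion -/

/-- An approximation of `U` is improved by the commutator of approximations of the balanced factors
of the remainder: all three approximations have the error `σ²`, and the new error is of order
`σ³`. -/
theorem exists_refinement_const (d : ℕ) : ∃ c : ℝ, 1 ≤ c ∧
    ∀ (U u v w : SU d) (σ : ℝ), 0 ≤ σ → σ ≤ 1 →
      ‖(U : Matrix (Fin d) (Fin d) ℂ) - u‖ ≤ σ ^ 2 →
      ‖leftFactor ((U : Matrix (Fin d) (Fin d) ℂ) * (u : Matrix (Fin d) (Fin d) ℂ)ᴴ) - v‖ ≤ σ ^ 2 →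
      ‖rightFactor ((U : Matrix (Fin d) (Fin d) ℂ) * (u : Matrix (Fin d) (Fin d) ℂ)ᴴ) - w‖ ≤ σ ^ 2 →
      ‖(U : Matrix (Fin d) (Fin d) ℂ) - (v * w * v⁻¹ * w⁻¹ * u : SU d)‖ ≤ c * σ ^ 3 := by
  obtain ⟨C, hC, h⟩ := exists_balanced_commutator d
  refine ⟨C + 4 * C + 2 + 8 * C ^ 2 + 1, by nlinarith [sq_nonneg C],
    fun U u v w σ hσ hσ1 hU hv hw => ?_⟩
  have hun : ∀ x : SU d, (x : Matrix (Fin d) (Fin d) ℂ) ∈ Matrix.unitaryGroup (Fin d) ℂ :=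
    fun x => (Matrix.mem_specialUnitaryGroup_iff.1 x.2).1
  have huu' : (u : Matrix (Fin d) (Fin d) ℂ)ᴴ * u = 1 := Matrix.mem_unitaryGroup_iff'.1 (hun u)
  have huu : (u : Matrix (Fin d) (Fin d) ℂ) * (u : Matrix (Fin d) (Fin d) ℂ)ᴴ = 1 :=
    Matrix.mem_unitaryGroup_iff.1 (hun u)
  have hinv : ∀ x : SU d, ((x⁻¹ : SU d) : Matrix (Fin d) (Fin d) ℂ) =
    (x : Matrix (Fin d) (Fin d) ℂ)ᴴ := fun x => rfl
  set Δ := (U : Matrix (Fin d) (Fin d) ℂ) * (u : Matrix (Fin d) (Fin d) ℂ)ᴴ with hΔ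
  have hΔmem : Δ ∈ Matrix.specialUnitaryGroup (Fin d) ℂ := (U * u⁻¹).2
  have huh : (u : Matrix (Fin d) (Fin d) ℂ)ᴴ ∈ Matrix.unitaryGroup (Fin d) ℂ := hun u⁻¹
  have hΔ1 : ‖Δ - 1‖ ≤ σ ^ 2 := by
    rw [← huu, hΔ, ← Matrix.sub_mul, norm_mul_unitary _ huh]
    exact hU
  obtain ⟨h1, h2, h3⟩ := h Δ hΔmem σ hσ hσ1 hΔ1
  have hVm : leftFactor Δ ∈ Matrix.unitaryGroup (Fin d) ℂ :=
    (Matrix.mem_specialUnitaryGroup_iff.1 (leftFactor_mem Δ)).1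
  have hWm : rightFactor Δ ∈ Matrix.unitaryGroup (Fin d) ℂ :=
    (Matrix.mem_specialUnitaryGroup_iff.1 (rightFactor_mem Δ)).1
  have hvm := hun v
  have hwm := hun w
  simp only [Submonoid.coe_mul, hinv]
  generalize leftFactor Δ = V at *
  generalize rightFactor Δ = W at *
  generalize (v : Matrix (Fin d) (Fin d) ℂ) = v at *
  generalize (w : Matrix (Fin d) (Fin d) ℂ) = w at *
  have e0 : (U : Matrix (Fin d) (Fin d) ℂ) - v * w * vᴴ * wᴴ * (u : Matrix (Fin d) (Fin d) ℂ) =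
      (Δ - v * w * vᴴ * wᴴ) * (u : Matrix (Fin d) (Fin d) ℂ) := by
    rw [Matrix.sub_mul, hΔ, Matrix.mul_assoc (U : Matrix (Fin d) (Fin d) ℂ), huu', Matrix.mul_one]
  rw [e0, norm_mul_unitary _ (hun u)]
  have hVVh : ∀ {A B : Matrix (Fin d) (Fin d) ℂ}, A ∈ Matrix.unitaryGroup (Fin d) ℂ →
      B ∈ Matrix.unitaryGroup (Fin d) ℂ →
      A * B * Aᴴ * Bᴴ = 1 + ((A - 1) * (B - 1) - (B - 1) * (A - 1)) * (Aᴴ * Bᴴ) := by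
    intro A B hA hB
    have e1 : (A - 1) * (B - 1) - (B - 1) * (A - 1) = A * B - B * A := by noncomm_ring
    have e2 : B * A * (Aᴴ * Bᴴ) = 1 := by
      calc B * A * (Aᴴ * Bᴴ) = B * (A * Aᴴ) * Bᴴ := by simp only [Matrix.mul_assoc]
        _ = 1 := by
          have hA' : A * Aᴴ = 1 := Matrix.mem_unitaryGroup_iff.1 hA
          have hB' : B * Bᴴ = 1 := Matrix.mem_unitaryGroup_iff.1 hB
          rw [hA', Matrix.mul_one, hB']
    rw [e1, Matrix.sub_mul, e2]
    simp only [Matrix.mul_assoc]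
    abel
  -- the commutator changes by `O(σ³)` since one of its two factors is within `O(σ)` of `1`
  have hcomm : V * W * Vᴴ * Wᴴ - v * w * vᴴ * wᴴ =
      ((V - v) * (W - 1) + (v - 1) * (W - w) - ((W - w) * (V - 1) + (w - 1) * (V - v)))
        * (vᴴ * wᴴ) +
      ((V - 1) * (W - 1) - (W - 1) * (V - 1)) * (Vᴴ * (W - w)ᴴ + (V - v)ᴴ * wᴴ) := by
    rw [hVVh hVm hWm, hVVh hvm hwm, Matrix.conjTranspose_sub, Matrix.conjTranspose_sub]
    noncomm_ring
  have hv1 : ‖v - 1‖ ≤ (C + 1) * σ := by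
    have e : v - 1 = (V - 1) - (V - v) := by abel
    rw [e]
    refine (norm_sub_le _ _).trans ?_
    nlinarith
  have hw1 : ‖w - 1‖ ≤ (C + 1) * σ := by
    have e : w - 1 = (W - 1) - (W - w) := by abel
    rw [e]
    refine (norm_sub_le _ _).trans ?_
    nlinarith
  have m : ∀ {A B : Matrix (Fin d) (Fin d) ℂ} {a b : ℝ}, ‖A‖ ≤ a → ‖B‖ ≤ b → ‖A * B‖ ≤ a * b :=
    fun {A B a b} ha hb => (norm_mul_le A B).trans
      (mul_le_mul ha hb (norm_nonneg _) ((norm_nonneg _).trans ha))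
  have hvh : vᴴ ∈ Matrix.unitaryGroup (Fin d) ℂ := Unitary.star_mem hvm
  have hwh : wᴴ ∈ Matrix.unitaryGroup (Fin d) ℂ := Unitary.star_mem hwm
  have hVh : Vᴴ ∈ Matrix.unitaryGroup (Fin d) ℂ := Unitary.star_mem hVm
  have hA : ‖(V - v) * (W - 1) + (v - 1) * (W - w) - ((W - w) * (V - 1) + (w - 1) * (V - v))‖ ≤
      (σ ^ 2 * (C * σ) + (C + 1) * σ * σ ^ 2) + (σ ^ 2 * (C * σ) + (C + 1) * σ * σ ^ 2) :=
    (norm_sub_le _ _).trans (add_le_add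
      ((norm_add_le _ _).trans (add_le_add (m hv h2) (m hv1 hw)))
      ((norm_add_le _ _).trans (add_le_add (m hw h1) (m hw1 hv))))
  have hB : ‖(V - 1) * (W - 1) - (W - 1) * (V - 1)‖ ≤ C * σ * (C * σ) + C * σ * (C * σ) :=
    (norm_sub_le _ _).trans (add_le_add (m h1 h2) (m h2 h1))
  have hD : ‖Vᴴ * (W - w)ᴴ + (V - v)ᴴ * wᴴ‖ ≤ σ ^ 2 + σ ^ 2 := by
    refine (norm_add_le _ _).trans ?_
    rw [norm_unitary_mul hVh, norm_mul_unitary _ hwh, Matrix.l2_opNorm_conjTranspose,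
      Matrix.l2_opNorm_conjTranspose]
    exact add_le_add hw hv
  have hE : ‖V * W * Vᴴ * Wᴴ - v * w * vᴴ * wᴴ‖ ≤ (4 * C + 2) * σ ^ 3 + 4 * C ^ 2 * σ ^ 3 := by
    rw [hcomm]
    refine (norm_add_le _ _).trans ?_
    rw [norm_mul_unitary _ (mul_mem hvh hwh)]
    refine (add_le_add hA (m hB hD)).trans ?_
    have h4 : σ ^ 4 ≤ σ ^ 3 := pow_le_pow_of_le_one hσ hσ1 (by norm_num)
    nlinarith [mul_le_mul_of_nonneg_left h4 (sq_nonneg C)]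
  have e5 : Δ - v * w * vᴴ * wᴴ = (Δ - V * W * Vᴴ * Wᴴ) +
      (V * W * Vᴴ * Wᴴ - v * w * vᴴ * wᴴ) := by abel
  rw [e5]
  refine (norm_add_le _ _).trans ((add_le_add h3 hE).trans ?_)
  have : 0 ≤ (4 * C ^ 2 + 1) * σ ^ 3 := by positivity
  linarith

/-! ### The accuracy reached at each level -/

/-- The accuracy at the levels of the recursion, up to a constant factor: `x₀ = 1/4` and
`xₙ₊₁ = xₙ ^ (3/2)`, where the power is written with a square root, as the program computes it. -/
def accuracy : ℕ → ℝ
  | 0 => 1 / 4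
  | n + 1 => accuracy n * Real.sqrt (accuracy n)

theorem accuracy_pos (n : ℕ) : 0 < accuracy n := by
  induction n with
  | zero => norm_num [accuracy]
  | succ n ih => rw [accuracy]; positivity

theorem accuracy_le (n : ℕ) : accuracy n ≤ 1 / 4 * (1 / 2) ^ n := by
  induction n with
  | zero => norm_num [accuracy]
  | succ n ih =>
    have h1 : accuracy n ≤ 1 / 4 := ih.trans (by
      have : ((1 : ℝ) / 2) ^ n ≤ 1 := pow_le_one₀ (by norm_num) (by norm_num)
      linarith)
    have h2 : Real.sqrt (accuracy n) ≤ 1 / 2 :=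
      Real.sqrt_le_iff.2 ⟨by norm_num, by norm_num; linarith⟩
    rw [accuracy, pow_succ]
    nlinarith [accuracy_pos n]

theorem log_accuracy (n : ℕ) : Real.log (accuracy n) = -((3 / 2) ^ n * Real.log 4) := by
  induction n with
  | zero => rw [accuracy, one_div, Real.log_inv, pow_zero, one_mul]
  | succ n ih =>
    have h := accuracy_pos n
    rw [accuracy, Real.log_mul h.ne' (Real.sqrt_pos.2 h).ne', Real.log_sqrt h.le, ih, pow_succ]
    ring

theorem exists_accuracy_lt {y : ℝ} (hy : 0 < y) :
    ∃ N, accuracy N < y ∧ ∀ n < N, y ≤ accuracy n := by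
  classical
  have h : ∃ N, accuracy N < y := by
    obtain ⟨N, hN⟩ := exists_pow_lt_of_lt_one hy (show (1 / 2 : ℝ) < 1 by norm_num)
    refine ⟨N, (accuracy_le N).trans_lt (lt_of_le_of_lt ?_ hN)⟩
    have : (0 : ℝ) ≤ (1 / 2) ^ N := by positivity
    linarith
  exact ⟨Nat.find h, Nat.find_spec h, fun n hn => not_lt.1 (Nat.find_min h hn)⟩

/-- The level needed for the accuracy `ε` is about `log_{3/2} log (1 / ε)`. -/
theorem pow_level_le {c ε : ℝ} (hc : 1 ≤ c) (hε : 0 < ε) {N : ℕ}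
    (hN : ∀ n < N, c ^ 2 * ε ≤ accuracy n) :
    (3 / 2 : ℝ) ^ N ≤ 3 / 2 * max 1 (Real.log (1 / ε)) := by
  rcases N with _ | n
  · have := le_max_left 1 (Real.log (1 / ε))
    rw [pow_zero]
    linarith
  · have h1 := hN n n.lt_succ_self
    have h2 : ε ≤ accuracy n := le_trans (by nlinarith [one_le_pow₀ hc (n := 2)]) h1
    have h3 := Real.log_le_log hε h2
    rw [log_accuracy] at h3
    have h4 : 1 ≤ Real.log 4 := by
      rw [show (4 : ℝ) = 2 ^ 2 by norm_num, Real.log_pow]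
      have := Real.log_two_gt_d9
      push_cast
      linarith
    have h5 : (3 / 2 : ℝ) ^ n ≤ Real.log (1 / ε) := by
      rw [one_div, Real.log_inv]
      have : (0 : ℝ) ≤ (3 / 2) ^ n := by positivity
      nlinarith
    have := le_max_right 1 (Real.log (1 / ε))
    rw [pow_succ]
    linarith

/-- If `(3/2)^N` is of order `L`, then `b^N` is of order `L ^ log_{3/2} b`. -/
theorem pow_le_rpow_of_level {b L : ℝ} (hb : 1 < b) (hL : 0 < L) {N : ℕ}
    (hN : (3 / 2 : ℝ) ^ N ≤ 3 / 2 * L) :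
    b ^ N ≤ b * L ^ (Real.log b / Real.log (3 / 2)) := by
  have hlog : 0 < Real.log (3 / 2) := Real.log_pos (by norm_num)
  have hα : 0 ≤ Real.log b / Real.log (3 / 2) := div_nonneg (Real.log_pos hb).le hlog.le
  have hbα : (3 / 2 : ℝ) ^ (Real.log b / Real.log (3 / 2)) = b := by
    rw [Real.rpow_def_of_pos (by norm_num), mul_div_cancel₀ _ hlog.ne', Real.exp_log (by linarith)]
  calc b ^ N = ((3 / 2 : ℝ) ^ N) ^ (Real.log b / Real.log (3 / 2)) := by
        rw [← Real.rpow_natCast (3 / 2), ← Real.rpow_mul (by norm_num), mul_comm,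
          Real.rpow_mul (by norm_num), hbα, Real.rpow_natCast]
    _ ≤ (3 / 2 * L) ^ (Real.log b / Real.log (3 / 2)) :=
        Real.rpow_le_rpow (by positivity) hN hα
    _ = b * L ^ (Real.log b / Real.log (3 / 2)) := by
        rw [Real.mul_rpow (by norm_num) hL.le, hbα]

/-! ### Matrices in the registers -/

/-- The matrix whose entries are held, in the order of the input, by the registers from `b` on. -/
def readMatrix (d b : ℕ) (r : ℕ → ℝ) : Matrix (Fin d) (Fin d) ℂ := Matrix.of fun i j =>
  ⟨r (b + (d * i + j)), r (b + (d * d + (d * i + j)))⟩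

/-- Registers that hold the matrix `A` and then the number `x`, in the order of the input. -/
def flatten (A : Matrix (Fin d) (Fin d) ℂ) (x : ℝ) (k : ℕ) : ℝ :=
  if h : k < d * d then (A (Fin.divNat ⟨k, h⟩) (Fin.modNat ⟨k, h⟩)).re
  else if h : k - d * d < d * d then
    (A (Fin.divNat ⟨k - d * d, h⟩) (Fin.modNat ⟨k - d * d, h⟩)).im
  else if k = 2 * d * d then x
  else 0

theorem inputReg_eq_flatten (U : SU d) (ε : ℝ) :
    inputReg U ε = flatten (U : Matrix (Fin d) (Fin d) ℂ) ε := rfl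

theorem index_lt (i j : Fin d) : d * (i : ℕ) + j < d * d := by
  have hi := i.isLt
  have hj := j.isLt
  calc d * (i : ℕ) + j < d * i + d := by omega
    _ = d * (i + 1) := by ring
    _ ≤ d * d := Nat.mul_le_mul_left _ hi

theorem divNat_index (i j : Fin d) (h : d * (i : ℕ) + j < d * d) :
    Fin.divNat ⟨d * (i : ℕ) + j, h⟩ = i := by
  ext
  simp only [Fin.coe_divNat]
  rw [Nat.mul_add_div (by have := j.isLt; omega), Nat.div_eq_of_lt j.isLt, add_zero]

theorem modNat_index (i j : Fin d) (h : d * (i : ℕ) + j < d * d) :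
    Fin.modNat ⟨d * (i : ℕ) + j, h⟩ = j := by
  ext
  simp only [Fin.coe_modNat]
  rw [Nat.mul_add_mod, Nat.mod_eq_of_lt j.isLt]

theorem readMatrix_flatten (A : Matrix (Fin d) (Fin d) ℂ) (x : ℝ) :
    readMatrix d 0 (flatten A x) = A := by
  ext i j
  have h := index_lt i j
  refine Complex.ext ?_ ?_
  · simp only [readMatrix, Matrix.of_apply, flatten, zero_add]
    rw [dif_pos h, divNat_index, modNat_index]
  · simp only [readMatrix, Matrix.of_apply, flatten, zero_add]
    have h1 : ¬ d * d + (d * (i : ℕ) + j) < d * d := by omega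
    have h2 : d * d + (d * (i : ℕ) + j) - d * d = d * (i : ℕ) + j := by omega
    rw [dif_neg h1, dif_pos (by rw [h2]; exact h)]
    simp only [h2]
    rw [divNat_index, modNat_index]

theorem flatten_last (A : Matrix (Fin d) (Fin d) ℂ) (x : ℝ) : flatten A x (2 * d * d) = x := by
  have h1 : ¬ 2 * d * d < d * d := by rw [mul_assoc]; omega
  have h2 : ¬ 2 * d * d - d * d < d * d := by rw [mul_assoc]; omega
  rw [flatten, dif_neg h1, dif_neg h2, if_pos rfl]

theorem loadArgs_flatten (A : Matrix (Fin d) (Fin d) ℂ) (x : ℝ) :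
    (loadArgs fun i : Fin (2 * d * d + 1) => flatten A x i) = flatten A x := by
  funext k
  rw [loadArgs]
  split_ifs with h
  · rfl
  · have h0 : 2 * d * d = d * d + d * d := by ring
    rw [flatten, dif_neg (by omega), dif_neg (by omega), if_neg (by omega)]

theorem isComputableM_readMatrix (b : ℕ) : IsComputableM (readMatrix d b) :=
  fun _ _ => ⟨.reg _, .reg _⟩

theorem isComputable_flatten {M : (ℕ → ℝ) → Matrix (Fin d) (Fin d) ℂ} (hM : IsComputableM M)
    {x : (ℕ → ℝ) → ℝ} (hx : IsComputable x) (k : ℕ) :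
    IsComputable fun r => flatten (M r) (x r) k := by
  unfold flatten
  split_ifs
  · exact (hM _ _).1
  · exact (hM _ _).2
  · exact hx
  · exact .const 0

/-- Reading a block of registers to which a matrix has been returned. -/
theorem readMatrix_storeResults (r r' : ℕ → ℝ) (x : ℕ) :
    readMatrix d x (storeResults r r' x (2 * d * d)) = readMatrix d 0 r' := by
  have h0 : 2 * d * d = d * d + d * d := by ring
  ext i j
  have h := index_lt i j
  simp only [readMatrix, Matrix.of_apply, storeResults]
  rw [if_pos (by omega), if_pos (by omega)]
  congr 2 <;> omega

/-- Reading a block of registers that is disjoint from the registers to which results have been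
returned. -/
theorem readMatrix_storeResults_of_disjoint (r r' : ℕ → ℝ) {b x m : ℕ}
    (hb : b + 2 * d * d ≤ x ∨ x + m ≤ b) :
    readMatrix d b (storeResults r r' x m) = readMatrix d b r := by
  have h0 : 2 * d * d = d * d + d * d := by ring
  ext i j
  have h := index_lt i j
  simp only [readMatrix, Matrix.of_apply, storeResults]
  rw [if_neg (by omega), if_neg (by omega)]

/-! ### Commands -/

section Commands

variable {Γ : Type}

theorem loadArgs_fin_zero {α : Type} [Zero α] (v : Fin 0 → α) : loadArgs v = fun _ => 0 := by
  funext i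
  simp [loadArgs]

/-- A command that calls a procedure on computable arguments: a matrix and a real number. -/
theorem exists_call (Γ : Type) (f y m p l : ℕ) {M : (ℕ → ℝ) → Matrix (Fin d) (Fin d) ℂ}
    (hM : IsComputableM M) {x : (ℕ → ℝ) → ℝ} (hx : IsComputable x) :
    ∃ (c : Cmd Γ) (T : ℕ), ∀ (P : Program Γ) (body : Cmd Γ) (s : State Γ) (t : ℕ) (s' : State Γ),
      P.procs[f]? = some body →
      Exec P body { reg := flatten (M s.reg) (x s.reg), ptr := fun _ => 0, store := s.store } t s' →
      ∃ t' ≤ t + T, Exec P c s t'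
        { reg := storeResults s.reg s'.reg y m
          ptr := storeResults s.ptr s'.ptr p l
          store := s'.store } := by
  obtain ⟨tree, htree⟩ := exists_tree_pi (n := 2 * d * d + 1)
    (F := fun i r => flatten (M r) (x r) i) fun i => isComputable_flatten hM hx i
  obtain ⟨B, hB⟩ := tree.exists_bound fun args => ∑ i, (args i).cost
  refine ⟨(tree.bind fun args =>
    .leaf (Cmd.call f args (Fin.elim0 : Fin 0 → ℕ) y m p l)).toCmd,
    B + 0 + m + l + 1 + DecisionTree.cost (tree.bind fun args =>
    .leaf (Cmd.call (Γ := Γ) f args (Fin.elim0 : Fin 0 → ℕ) y m p l)), ?_⟩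
  intro P body s t s' hbody hexec
  have hcall := Exec.call (P := P) (f := f) (x := y) (m := m) (y := p) (l := l)
    (args := tree.select s.reg) (pargs := (Fin.elim0 : Fin 0 → ℕ)) (body := body) (s := s)
    (s' := s') (t := t) hbody (by
      simp only [htree, loadArgs_flatten, loadArgs_fin_zero]
      exact hexec)
  obtain ⟨t', ht', hx'⟩ := DecisionTree.exec_toCmd (tree.bind fun args =>
    .leaf (Cmd.call f args (Fin.elim0 : Fin 0 → ℕ) y m p l)) (P := P) (s := s)
    (by rw [DecisionTree.select_bind, DecisionTree.select]; exact hcall)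
  refine ⟨t', ht'.trans ?_, hx'⟩
  have := hB s.reg
  omega

/-- A command that stores the word `w`, with a pointer to it in the register `x`; the register
`y` is used for the letters. -/
def storeWordCmd (x y : ℕ) : List Γ → Cmd Γ
  | [] => .newEmpty x
  | g :: w => .seq (storeWordCmd x y w) (.seq (.newLetter y g) (.newConcat x y x))

theorem exec_storeWordCmd (P : Program Γ) {x y : ℕ} (hxy : x ≠ y) (w : List Γ) (s : State Γ) :
    ∃ s', Exec P (storeWordCmd x y w) s (2 * w.length + 1) s' ∧ s'.reg = s.reg ∧
      s.store <+: s'.store ∧ Denotes s'.store (s'.ptr x) w ∧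
      ∀ z v, z ≠ x → z ≠ y → Denotes s.store (s.ptr z) v → Denotes s'.store (s'.ptr z) v := by
  induction w with
  | nil =>
    refine ⟨_, Exec.newEmpty x s, rfl, List.prefix_append _ _, ?_, fun z v hz _ hv => ?_⟩
    · simpa [State.alloc] using denotes_empty s.store
    · simpa [State.alloc, hz] using hv.mono (List.prefix_append _ _)
  | cons g w ih =>
    obtain ⟨s', he, hr, hs, hd, hp⟩ := ih
    refine ⟨_, Exec.seq (t := 2 * w.length + 1) (t' := 1 + 1) he
      (Exec.seq (Exec.newLetter y g s') (Exec.newConcat x y x _)), hr, ?_, ?_,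
      fun z v hzx hzy hv => ?_⟩
    · exact hs.trans ((List.prefix_append _ _).trans (List.prefix_append _ _))
    · have h1 : Denotes (s'.store ++ [Cell.letter g]) s'.store.length [g] := denotes_letter _ _
      have h2 := hd.mono (List.prefix_append s'.store [Cell.letter g])
      simpa [State.alloc, hxy] using h1.concat h2
    · simpa [State.alloc, hzx, hzy] using ((hp z v hzx hzy hv).mono
        (List.prefix_append _ [Cell.letter g])).mono (List.prefix_append _ _)

theorem exec_newConcat (P : Program Γ) (x : ℕ) {y z : ℕ} {s : State Γ} {v w : List Γ}
    (hy : Denotes s.store (s.ptr y) v) (hz : Denotes s.store (s.ptr z) w) :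
    ∃ s', Exec P (.newConcat x y z) s 1 s' ∧ s'.reg = s.reg ∧ s.store <+: s'.store ∧
      Denotes s'.store (s'.ptr x) (v ++ w) ∧
      ∀ i u, i ≠ x → Denotes s.store (s.ptr i) u → Denotes s'.store (s'.ptr i) u :=
  ⟨_, Exec.newConcat x y z s, rfl, List.prefix_append _ _,
    by simpa [State.alloc] using hy.concat hz,
    fun i u hi hu => by simpa [State.alloc, hi] using hu.mono (List.prefix_append _ _)⟩

end Commands

/-! ### The choice of the level -/

/-- The procedure that finds the level.  Its arguments are a level, the accuracy at this level, and
the required accuracy. -/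
def levelProc (Γ : Type) : Cmd Γ :=
  .ifLE (.reg 2) (.reg 1)
    (.call 0 ![.add (.reg 0) (.const 1), .mul (.reg 1) (.sqrt (.reg 1)), .reg 2]
      (Fin.elim0 : Fin 0 → ℕ) 0 1 0 0)
    .skip

/-- Started at the level `n`, the procedure returns the first level `N` with the required
accuracy; each of the `N - n` recursive calls takes fewer than `20` steps of its own. -/
theorem exec_levelProc {Γ : Type} {P : Program Γ} (hP : P.procs[0]? = some (levelProc Γ)) {y : ℝ}
    {N : ℕ} (hN : accuracy N < y) (h : ∀ n < N, y ≤ accuracy n) (store : List (Cell Γ)) (k n : ℕ)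
    (hk : n + k = N) :
    ∃ (t : ℕ) (s' : State Γ), t ≤ 20 * (k + 1) ∧ s'.reg 0 = N ∧ s'.store = store ∧
      Exec P (levelProc Γ)
      { reg := loadArgs ![(n : ℝ), accuracy n, y], ptr := fun _ => 0, store := store } t s' := by
  induction k generalizing n with
  | zero =>
    obtain rfl : n = N := by omega
    refine ⟨_, _, ?_, ?_, ?_, Exec.ifFalse ?_ (Exec.skip _)⟩
    · simp [RExpr.cost]
    · simp [loadArgs]
    · rfl
    · simpa [RExpr.eval, loadArgs] using hN
  | succ k ih =>
    obtain ⟨t, s', ht, hr, hs, he⟩ := ih (n + 1) (by omega)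
    refine ⟨_, _, ?_, ?_, ?_, Exec.ifTrue ?_ (Exec.call (t := t) (s' := s') hP ?_)⟩
    · simp only [RExpr.cost, Fin.sum_univ_three]
      simp only [Matrix.cons_val, RExpr.cost]
      omega
    · simp [storeResults, hr]
    · exact hs
    · simpa [RExpr.eval, loadArgs] using h n (by omega)
    · convert! he using 2
      · congr 1
        funext i
        fin_cases i <;> simp [RExpr.eval, loadArgs, accuracy]

/-! ### The recursive procedure -/

/-- In the state `s'`, reached from a state with the store `h`, the procedure has returned a word of
length at most `L` over `G` whose product is within `δ` of `U`: the product is in the first real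
registers, and the pointer registers `0` and `1` denote the word and its inverse. -/
def ReturnsApproximation (G : Finset (SU d)) (U : SU d) (δ : ℝ) (L : ℕ) (h : List (Cell (SU d)))
    (s' : State (SU d)) : Prop :=
  ∃ w : List (SU d), (∀ g ∈ w, g ∈ G) ∧ ‖(U : Matrix (Fin d) (Fin d) ℂ) - (w.prod : SU d)‖ ≤ δ ∧
    w.length ≤ L ∧ readMatrix d 0 s'.reg = (w.prod : SU d) ∧ h <+: s'.store ∧
    Denotes s'.store (s'.ptr 0) w ∧ Denotes s'.store (s'.ptr 1) (invWord w)

theorem storeResults_zero {α : Type} (r r' : ℕ → α) (x : ℕ) : storeResults r r' x 0 = r := by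
  funext i
  rw [storeResults, if_neg (by omega)]

/-- A command that writes a computable matrix to the first registers, by calling a procedure that
does nothing. -/
theorem exists_writeMatrix (Γ : Type) {M : (ℕ → ℝ) → Matrix (Fin d) (Fin d) ℂ}
    (hM : IsComputableM M) :
    ∃ (c : Cmd Γ) (T : ℕ), ∀ (P : Program Γ) (s : State Γ), P.procs[2]? = some .skip →
      ∃ t ≤ T, ∃ s', Exec P c s t s' ∧ readMatrix d 0 s'.reg = M s.reg ∧ s'.ptr = s.ptr ∧
        s'.store = s.store := by
  obtain ⟨c, T, h⟩ := exists_call Γ 2 0 (2 * d * d) 0 0 hM (.const 0)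
  refine ⟨c, 1 + T, fun P s hP => ?_⟩
  obtain ⟨t, ht, he⟩ := h P _ s 1 _ hP (Exec.skip _)
  exact ⟨t, ht, _, he, by rw [readMatrix_storeResults, readMatrix_flatten],
    by simp only [storeResults_zero], rfl⟩

/-- A command that returns a given word. -/
theorem exists_returnWord (w : List (SU d)) :
    ∃ (c : Cmd (SU d)) (T : ℕ), ∀ (P : Program (SU d)) (s : State (SU d)),
      P.procs[2]? = some .skip →
      ∃ t ≤ T, ∃ s', Exec P c s t s' ∧ readMatrix d 0 s'.reg = (w.prod : SU d) ∧
        s.store <+: s'.store ∧ Denotes s'.store (s'.ptr 0) w ∧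
        Denotes s'.store (s'.ptr 1) (invWord w) := by
  obtain ⟨c, T, h⟩ := exists_writeMatrix (SU d)
    (IsComputableM.const ((w.prod : SU d) : Matrix (Fin d) (Fin d) ℂ))
  refine ⟨.seq (storeWordCmd 0 2 w) (.seq (storeWordCmd 1 2 (invWord w)) c),
    (2 * w.length + 1) + ((2 * (invWord w).length + 1) + T), fun P s hP => ?_⟩
  obtain ⟨s₁, he₁, -, hs₁, hd₁, -⟩ := exec_storeWordCmd P (x := 0) (y := 2) (by norm_num) w s
  obtain ⟨s₂, he₂, -, hs₂, hd₂, hp₂⟩ :=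
    exec_storeWordCmd P (x := 1) (y := 2) (by norm_num) (invWord w) s₁
  obtain ⟨t, ht, s₃, he₃, hm₃, hp₃, hs₃⟩ := h P s₂ hP
  refine ⟨_, ?_, s₃, Exec.seq he₁ (Exec.seq he₂ he₃), hm₃, ?_, ?_, ?_⟩
  · omega
  · rw [hs₃]; exact hs₁.trans hs₂
  · rw [hs₃, hp₃]; exact hp₂ 0 w (by norm_num) (by norm_num) hd₁
  · rw [hs₃, hp₃]; exact hd₂

/-- A decision tree that searches a finite list of words for one that approximates the matrix in
the registers. -/
theorem exists_searchTree (l : List (List (SU d))) (δ : ℝ) :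
    ∃ t : DecisionTree (List (SU d)), ∀ r : ℕ → ℝ,
      (∃ w ∈ l, ∑ i, ∑ j, ‖(readMatrix d 0 r - (w.prod : SU d)) i j‖ ≤ δ) →
      t.select r ∈ l ∧
        ∑ i, ∑ j, ‖(readMatrix d 0 r - ((t.select r).prod : SU d)) i j‖ ≤ δ := by
  induction l with
  | nil => exact ⟨.leaf [], fun r ⟨w, hw, _⟩ => by simp at hw⟩
  | cons w l ih =>
    obtain ⟨t, ht⟩ := ih
    have hc : IsComputable fun r =>
        ∑ i, ∑ j, ‖(readMatrix d 0 r - ((w.prod : SU d) : Matrix (Fin d) (Fin d) ℂ)) i j‖ :=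
      IsComputable.sum _ fun i => IsComputable.sum _ fun j =>
        ((isComputableM_readMatrix 0).sub (.const _) i j).norm
    obtain ⟨u, hu⟩ := exists_tree_ite hc (.const δ) (.leaf w) t
    refine ⟨u, fun r hr => ?_⟩
    by_cases h : ∑ i, ∑ j, ‖(readMatrix d 0 r -
        ((w.prod : SU d) : Matrix (Fin d) (Fin d) ℂ)) i j‖ ≤ δ
    · rw [(hu r).1 h]
      exact ⟨List.mem_cons_self, h⟩
    · rw [(hu r).2 h]
      have := ht r (by
        obtain ⟨v, hv, hvδ⟩ := hr
        rcases List.mem_cons.1 hv with rfl | hv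
        · exact absurd hvδ h
        · exact ⟨v, hv, hvδ⟩)
      exact ⟨List.mem_cons_of_mem _ this.1, this.2⟩

/-- The bottom of the recursion: a fixed accuracy is reached by looking up a finite net. -/
theorem exists_lookup {G : Finset (SU d)} (hG : IsInstructionSet G) {δ : ℝ} (hδ : 0 < δ) :
    ∃ (c : Cmd (SU d)) (T L : ℕ), ∀ (P : Program (SU d)) (U : SU d) (s : State (SU d)),
      P.procs[2]? = some .skip → readMatrix d 0 s.reg = U →
      ∃ t ≤ T, ∃ s', Exec P c s t s' ∧ ReturnsApproximation G U δ L s.store s' := by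
  obtain ⟨l, hlG, hl⟩ := exists_net hG (show 0 < δ / (d * d + 1) by positivity)
  obtain ⟨tree, htree⟩ := exists_searchTree l δ
  choose cmd T hcmd using exists_returnWord (d := d)
  obtain ⟨B, hB⟩ := tree.exists_bound T
  obtain ⟨L, hL⟩ := tree.exists_bound List.length
  refine ⟨(tree.bind fun w => .leaf (cmd w)).toCmd,
    B + (tree.bind fun w => .leaf (cmd w)).cost, L, fun P U s hP hU => ?_⟩
  obtain ⟨hmem, hsum⟩ := htree s.reg (by
    obtain ⟨w, hw, hUw⟩ := hl U
    refine ⟨w, hw, ?_⟩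
    rw [hU]
    have h : ∑ i, ∑ j, ‖((U : Matrix (Fin d) (Fin d) ℂ) - (w.prod : SU d)) i j‖ ≤
        ∑ _i : Fin d, ∑ _j : Fin d, δ / (d * d + 1) :=
      Finset.sum_le_sum fun i _ => Finset.sum_le_sum fun j _ => (norm_entry_le _ _ _).trans hUw.le
    refine h.trans ?_
    simp only [Finset.sum_const, Finset.card_univ, Fintype.card_fin, nsmul_eq_mul]
    rw [← mul_assoc, mul_div_assoc', div_le_iff₀ (by positivity)]
    nlinarith)
  obtain ⟨t, ht, s', he, hm, hs, hd0, hd1⟩ := hcmd (tree.select s.reg) P s hP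
  obtain ⟨t', ht', he'⟩ := DecisionTree.exec_toCmd (tree.bind fun w => .leaf (cmd w)) (P := P)
    (s := s) (by rw [DecisionTree.select_bind, DecisionTree.select]; exact he)
  refine ⟨t', ?_, s', he', tree.select s.reg, hlG _ hmem, ?_, hL _, hm, hs, hd0, hd1⟩
  · have := hB s.reg
    omega
  · rw [hU] at hsum
    exact (norm_le_sum_entries _).trans hsum

/-- Given pointers to `u, u⁻¹, v, v⁻¹, w, w⁻¹` in the registers `0, …, 5`, this command stores
`v w v⁻¹ w⁻¹ u` and its inverse, with pointers in the registers `0` and `1`. -/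
def combineCmd (Γ : Type) : Cmd Γ :=
  .seq (.newConcat 6 2 4) <| .seq (.newConcat 7 3 5) <| .seq (.newConcat 8 7 0) <|
  .seq (.newConcat 9 4 2) <| .seq (.newConcat 10 5 3) <| .seq (.newConcat 11 9 10) <|
  .seq (.newConcat 0 6 8) (.newConcat 1 1 11)

theorem exec_combineCmd {Γ : Type} (P : Program Γ) {s : State Γ} {u u' v v' w w' : List Γ}
    (h0 : Denotes s.store (s.ptr 0) u) (h1 : Denotes s.store (s.ptr 1) u')
    (h2 : Denotes s.store (s.ptr 2) v) (h3 : Denotes s.store (s.ptr 3) v')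
    (h4 : Denotes s.store (s.ptr 4) w) (h5 : Denotes s.store (s.ptr 5) w') :
    ∃ s', Exec P (combineCmd Γ) s 8 s' ∧ s'.reg = s.reg ∧ s.store <+: s'.store ∧
      Denotes s'.store (s'.ptr 0) ((v ++ w) ++ ((v' ++ w') ++ u)) ∧
      Denotes s'.store (s'.ptr 1) (u' ++ ((w ++ v) ++ (w' ++ v'))) := by
  obtain ⟨s₁, e₁, r₁, p₁, d₁, k₁⟩ := exec_newConcat P 6 h2 h4
  obtain ⟨s₂, e₂, r₂, p₂, d₂, k₂⟩ := exec_newConcat P 7 (k₁ 3 _ (by norm_num) h3)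
    (k₁ 5 _ (by norm_num) h5)
  have k₂' : ∀ i x, i ≠ 6 → i ≠ 7 → Denotes s.store (s.ptr i) x → Denotes s₂.store (s₂.ptr i) x :=
    fun i x h6 h7 h => k₂ i x h7 (k₁ i x h6 h)
  obtain ⟨s₃, e₃, r₃, p₃, d₃, k₃⟩ := exec_newConcat P 8 d₂ (k₂' 0 _ (by norm_num) (by norm_num) h0)
  have k₃' : ∀ i x, i < 6 → Denotes s.store (s.ptr i) x → Denotes s₃.store (s₃.ptr i) x :=
    fun i x h6 h => k₃ i x (by omega) (k₂' i x (by omega) (by omega) h)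
  obtain ⟨s₄, e₄, r₄, p₄, d₄, k₄⟩ := exec_newConcat P 9 (k₃' 4 _ (by norm_num) h4)
    (k₃' 2 _ (by norm_num) h2)
  have k₄' : ∀ i x, i < 6 → Denotes s.store (s.ptr i) x → Denotes s₄.store (s₄.ptr i) x :=
    fun i x h6 h => k₄ i x (by omega) (k₃' i x h6 h)
  obtain ⟨s₅, e₅, r₅, p₅, d₅, k₅⟩ := exec_newConcat P 10 (k₄' 5 _ (by norm_num) h5)
    (k₄' 3 _ (by norm_num) h3)
  obtain ⟨s₆, e₆, r₆, p₆, d₆, k₆⟩ := exec_newConcat P 11 (k₅ 9 _ (by norm_num) d₄) d₅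
  have k₆' : ∀ i x, i < 9 → Denotes s₃.store (s₃.ptr i) x → Denotes s₆.store (s₆.ptr i) x :=
    fun i x h9 h => k₆ i x (by omega) (k₅ i x (by omega) (k₄ i x (by omega) h))
  obtain ⟨s₇, e₇, r₇, p₇, d₇, k₇⟩ := exec_newConcat P 0
    (k₆' 6 _ (by norm_num) (k₃ 6 _ (by norm_num) (k₂ 6 _ (by norm_num) d₁)))
    (k₆' 8 _ (by norm_num) d₃)
  obtain ⟨s₈, e₈, r₈, p₈, d₈, k₈⟩ := exec_newConcat P 1
    (k₇ 1 _ (by norm_num) (k₆' 1 _ (by norm_num) (k₃' 1 _ (by norm_num) h1)))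
    (k₇ 11 _ (by norm_num) d₆)
  refine ⟨s₈, ?_, ?_, ?_, k₈ 0 _ (by norm_num) d₇, d₈⟩
  · exact .seq e₁ (.seq e₂ (.seq e₃ (.seq e₄ (.seq e₅ (.seq e₆ (.seq e₇ e₈))))))
  · rw [r₈, r₇, r₆, r₅, r₄, r₃, r₂, r₁]
  · exact p₁.trans (p₂.trans (p₃.trans (p₄.trans (p₅.trans (p₆.trans (p₇.trans p₈))))))

/-- The recursive step: three calls at the previous level, and a bounded number of further
steps. -/
theorem exists_step (G : Finset (SU d)) (hG : IsInstructionSet G) {c : ℝ}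
    (hc : ∀ (U u v w : SU d) (σ : ℝ), 0 ≤ σ → σ ≤ 1 →
      ‖(U : Matrix (Fin d) (Fin d) ℂ) - u‖ ≤ σ ^ 2 →
      ‖leftFactor ((U : Matrix (Fin d) (Fin d) ℂ) * (u : Matrix (Fin d) (Fin d) ℂ)ᴴ) - v‖ ≤ σ ^ 2 →
      ‖rightFactor ((U : Matrix (Fin d) (Fin d) ℂ) * (u : Matrix (Fin d) (Fin d) ℂ)ᴴ) - w‖ ≤ σ ^ 2 →
      ‖(U : Matrix (Fin d) (Fin d) ℂ) - (v * w * v⁻¹ * w⁻¹ * u : SU d)‖ ≤ c * σ ^ 3) :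
    ∃ (cmd : Cmd (SU d)) (T : ℕ), ∀ (P : Program (SU d)) (body : Cmd (SU d)),
      P.procs[1]? = some body → P.procs[2]? = some .skip →
      ∀ (τ L n : ℕ) (σ : ℝ), 0 ≤ σ → σ ≤ 1 →
      (∀ (U : SU d) (h : List (Cell (SU d))), ∃ t ≤ τ, ∃ s', Exec P body
        { reg := flatten (U : Matrix (Fin d) (Fin d) ℂ) n, ptr := fun _ => 0, store := h } t s' ∧
          ReturnsApproximation G U (σ ^ 2) L h s') →
      ∀ (U : SU d) (s : State (SU d)), readMatrix d 0 s.reg = U → s.reg (2 * d * d) = n + 1 →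
        ∃ t ≤ 3 * τ + T, ∃ s', Exec P cmd s t s' ∧
          ReturnsApproximation G U (c * σ ^ 3) (5 * L) s.store s' := by
  set D := 2 * d * d with hD
  have hx : IsComputable fun r => r D - 1 := (IsComputable.reg D).sub (.const 1)
  have hM₀ : IsComputableM (readMatrix d 0) := isComputableM_readMatrix 0
  have hM₁ : IsComputableM fun r => readMatrix d 0 r * (readMatrix d (D + 1) r)ᴴ :=
    hM₀.mul (isComputableM_readMatrix _).conjTranspose
  have hM₂ := isComputableM_readMatrix (d := d) (2 * D + 1)
  have hM₃ := isComputableM_readMatrix (d := d) (3 * D + 1)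
  obtain ⟨c₁, T₁, h₁⟩ := exists_call (SU d) 1 (D + 1) D 0 2 hM₀ hx
  obtain ⟨c₂, T₂, h₂⟩ := exists_call (SU d) 1 (2 * D + 1) D 2 2 (isComputableM_leftFactor hM₁) hx
  obtain ⟨c₃, T₃, h₃⟩ := exists_call (SU d) 1 (3 * D + 1) D 4 2 (isComputableM_rightFactor hM₁) hx
  obtain ⟨c₅, T₅, h₅⟩ := exists_writeMatrix (SU d)
    ((((hM₂.mul hM₃).mul hM₂.conjTranspose).mul hM₃.conjTranspose).mul
      (isComputableM_readMatrix (D + 1)))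
  refine ⟨.seq c₁ (.seq c₂ (.seq c₃ (.seq (combineCmd _) c₅))), T₁ + (T₂ + (T₃ + (8 + T₅))), ?_⟩
  intro P body hP1 hP2 τ L n σ hσ hσ1 ih U s hU hn
  have hn' : s.reg D - 1 = n := by rw [hn]; ring
  -- the approximation `u` of `U`
  obtain ⟨t₁, ht₁, s₁', he₁', wu, hGu, hδu, hLu, hmu, hsu, hdu, hdu'⟩ := ih U s.store
  obtain ⟨t₁', ht₁', he₁⟩ := h₁ P body s t₁ s₁' hP1 (by rw [hU, hn']; exact he₁')
  set s₁ : State (SU d) := ⟨storeResults s.reg s₁'.reg (D + 1) D,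
    storeResults s.ptr s₁'.ptr 0 2, s₁'.store⟩ with hs₁
  have a₁ : readMatrix d 0 s₁.reg = U := by
    rw [← hU]; exact readMatrix_storeResults_of_disjoint _ _ (by omega)
  have b₁ : readMatrix d (D + 1) s₁.reg = (wu.prod : SU d) := by
    rw [← hmu]; exact readMatrix_storeResults _ _ _
  have n₁ : s₁.reg D - 1 = n := by
    rw [← hn']; simp [hs₁, storeResults]
  have p₁ : Denotes s₁.store (s₁.ptr 0) wu := by simpa [hs₁, storeResults] using hdu
  have q₁ : Denotes s₁.store (s₁.ptr 1) (invWord wu) := by simpa [hs₁, storeResults] using hdu'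
  have hst₁ : s.store <+: s₁.store := hsu
  clear_value s₁
  -- the approximation `v` of the left factor
  set Δ := (U : Matrix (Fin d) (Fin d) ℂ) * ((wu.prod : SU d) : Matrix (Fin d) (Fin d) ℂ)ᴴ with hΔ
  obtain ⟨t₂, ht₂, s₂', he₂', wv, hGv, hδv, hLv, hmv, hsv, hdv, hdv'⟩ :=
    ih ⟨leftFactor Δ, leftFactor_mem Δ⟩ s₁.store
  obtain ⟨t₂', ht₂', he₂⟩ := h₂ P body s₁ t₂ s₂' hP1 (by rw [a₁, b₁, n₁]; exact he₂')
  set s₂ : State (SU d) := ⟨storeResults s₁.reg s₂'.reg (2 * D + 1) D,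
    storeResults s₁.ptr s₂'.ptr 2 2, s₂'.store⟩ with hs₂
  have a₂ : readMatrix d 0 s₂.reg = U := by
    rw [← a₁]; exact readMatrix_storeResults_of_disjoint _ _ (by omega)
  have b₂ : readMatrix d (D + 1) s₂.reg = (wu.prod : SU d) := by
    rw [← b₁]; exact readMatrix_storeResults_of_disjoint _ _ (by omega)
  have c₂ : readMatrix d (2 * D + 1) s₂.reg = (wv.prod : SU d) := by
    rw [← hmv]; exact readMatrix_storeResults _ _ _
  have n₂ : s₂.reg D - 1 = n := by
    rw [← n₁, hs₂]; simp only [storeResults]; rw [if_neg (by omega)]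
  have p₂ : Denotes s₂.store (s₂.ptr 0) wu := by
    simpa [hs₂, storeResults] using p₁.mono hsv
  have q₂ : Denotes s₂.store (s₂.ptr 1) (invWord wu) := by
    simpa [hs₂, storeResults] using q₁.mono hsv
  have p₂' : Denotes s₂.store (s₂.ptr 2) wv := by simpa [hs₂, storeResults] using hdv
  have q₂' : Denotes s₂.store (s₂.ptr 3) (invWord wv) := by simpa [hs₂, storeResults] using hdv'
  have hst₂ : s₁.store <+: s₂.store := hsv
  clear_value s₂
  -- the approximation `w` of the right factor
  obtain ⟨t₃, ht₃, s₃', he₃', ww, hGw, hδw, hLw, hmw, hsw, hdw, hdw'⟩ :=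
    ih ⟨rightFactor Δ, rightFactor_mem Δ⟩ s₂.store
  obtain ⟨t₃', ht₃', he₃⟩ := h₃ P body s₂ t₃ s₃' hP1 (by rw [a₂, b₂, n₂]; exact he₃')
  set s₃ : State (SU d) := ⟨storeResults s₂.reg s₃'.reg (3 * D + 1) D,
    storeResults s₂.ptr s₃'.ptr 4 2, s₃'.store⟩ with hs₃
  have b₃ : readMatrix d (D + 1) s₃.reg = (wu.prod : SU d) := by
    rw [← b₂]; exact readMatrix_storeResults_of_disjoint _ _ (by omega)
  have c₃ : readMatrix d (2 * D + 1) s₃.reg = (wv.prod : SU d) := by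
    rw [← c₂]; exact readMatrix_storeResults_of_disjoint _ _ (by omega)
  have d₃ : readMatrix d (3 * D + 1) s₃.reg = (ww.prod : SU d) := by
    rw [← hmw]; exact readMatrix_storeResults _ _ _
  obtain ⟨s₄, he₄, hr₄, hs₄, hd₄, hd₄'⟩ := exec_combineCmd P (s := s₃) (u := wu)
    (u' := invWord wu) (v := wv) (v' := invWord wv) (w := ww) (w' := invWord ww)
    (by simpa [hs₃, storeResults] using p₂.mono hsw)
    (by simpa [hs₃, storeResults] using q₂.mono hsw)
    (by simpa [hs₃, storeResults] using p₂'.mono hsw)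
    (by simpa [hs₃, storeResults] using q₂'.mono hsw)
    (by simpa [hs₃, storeResults] using hdw) (by simpa [hs₃, storeResults] using hdw')
  have hst₃ : s₂.store <+: s₃.store := hsw
  clear_value s₃
  obtain ⟨t₅, ht₅, s₅, he₅, hm₅, hp₅, hs₅⟩ := h₅ P s₄ hP2
  have hprod : ((wv ++ ww) ++ ((invWord wv ++ invWord ww) ++ wu)).prod =
      wv.prod * ww.prod * (wv.prod)⁻¹ * (ww.prod)⁻¹ * wu.prod := by
    simp only [List.prod_append, prod_invWord, mul_assoc]
  refine ⟨_, ?_, s₅, .seq he₁ (.seq he₂ (.seq he₃ (.seq he₄ he₅))),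
    (wv ++ ww) ++ ((invWord wv ++ invWord ww) ++ wu), ?_, ?_, ?_, ?_, ?_, ?_, ?_⟩
  · omega
  · intro g hg
    simp only [List.mem_append] at hg
    rcases hg with (h | h) | (h | h) | h
    · exact hGv g h
    · exact hGw g h
    · exact invWord_mem hG hGv g h
    · exact invWord_mem hG hGw g h
    · exact hGu g h
  · rw [hprod]
    exact hc U wu.prod wv.prod ww.prod σ hσ hσ1 hδu hδv hδw
  · simp only [List.length_append, length_invWord]
    omega
  · rw [hm₅, hr₄, hprod, b₃, c₃, d₃]
    rfl
  · rw [hs₅]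
    exact hst₁.trans (hst₂.trans (hst₃.trans hs₄))
  · rw [hs₅, hp₅]; exact hd₄
  · rw [hs₅, hp₅]
    simpa only [invWord_append, invWord_invWord, List.append_assoc] using hd₄'

/-! ### The program -/

/-- The program: after the level has been found by `levelProc`, the recursive procedure is called.
The accuracy at level `n` is `accuracy n / c ^ 2`, so that a refinement with constant `c` leads from
one level to the next. -/
theorem exists_program {G : Finset (SU d)} (hG : IsInstructionSet G) :
    ∃ (P : Program (SU d)) (c : ℝ) (K : ℕ), 1 ≤ c ∧ ∀ (ε : ℝ) (N : ℕ), accuracy N < c ^ 2 * ε →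
      (∀ n < N, c ^ 2 * ε ≤ accuracy n) → ∀ U : SU d, ∃ (t : ℕ) (w : List (SU d)),
        P.Outputs U ε t w ∧ IsApproximation G U ε w ∧ w.length ≤ K * 5 ^ N ∧ t ≤ K * 3 ^ N := by
  obtain ⟨c, hc1, hc⟩ := exists_refinement_const d
  have hc0 : 0 < c := by linarith
  obtain ⟨base, T₀, L, hbase⟩ := exists_lookup hG (δ := accuracy 0 / c ^ 2)
    (div_pos (accuracy_pos 0) (by positivity))
  obtain ⟨step, T₁, hstep⟩ := exists_step G hG hc
  set D := 2 * d * d with hD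
  obtain ⟨start, T₂, hstart⟩ := exists_call (SU d) 1 0 0 0 2
    (isComputableM_readMatrix (d := d) 0) (.reg D)
  set body : Cmd (SU d) := .ifLE (.reg D) (.const (1 / 2)) base step
  set find : Cmd (SU d) := .call 0 ![.const 0, .const (1 / 4), .mul (.const (c ^ 2)) (.reg D)]
    (Fin.elim0 : Fin 0 → ℕ) D 1 0 0
  set P : Program (SU d) := ⟨.seq find start, [levelProc _, body, .skip]⟩
  -- the recursion `t' ≤ 3 t + T₁ + 3` preserves the bound `t + T₁ + 3 ≤ (T₀ + T₁ + 6) * 3 ^ n`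
  have hrec : ∀ (n : ℕ) (U : SU d) (h : List (Cell (SU d))),
      ∃ t ≤ (T₀ + T₁ + 6) * 3 ^ n - (T₁ + 3), ∃ s', Exec P body
        { reg := flatten (U : Matrix (Fin d) (Fin d) ℂ) n, ptr := fun _ => 0, store := h } t s' ∧
          ReturnsApproximation G U (accuracy n / c ^ 2) (5 ^ n * L) h s' := by
    intro n
    induction n with
    | zero =>
      intro U h
      obtain ⟨t, ht, s', he, hr⟩ := hbase P U
        ⟨flatten (U : Matrix (Fin d) (Fin d) ℂ) (0 : ℕ), fun _ => 0, h⟩ rfl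
        (readMatrix_flatten _ _)
      refine ⟨_, ?_, s', Exec.ifTrue ?_ he, by simpa using hr⟩
      · simp only [RExpr.cost, pow_zero, mul_one]
        omega
      · simp [RExpr.eval, flatten_last, hD]
    | succ n ih =>
      intro U h
      have ha := accuracy_pos n
      have ha1 : accuracy n ≤ 1 := (accuracy_le n).trans (by
        have : ((1 : ℝ) / 2) ^ n ≤ 1 := pow_le_one₀ (by norm_num) (by norm_num)
        linarith)
      have hσ : (Real.sqrt (accuracy n) / c) ^ 2 = accuracy n / c ^ 2 := by
        rw [div_pow, Real.sq_sqrt ha.le]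
      have hσ' : c * (Real.sqrt (accuracy n) / c) ^ 3 = accuracy (n + 1) / c ^ 2 := by
        rw [accuracy, div_pow, pow_succ (Real.sqrt (accuracy n)), Real.sq_sqrt ha.le]
        field_simp
      have hσ1 : Real.sqrt (accuracy n) / c ≤ 1 :=
        (div_le_self (Real.sqrt_nonneg _) hc1).trans (Real.sqrt_le_one.2 ha1)
      obtain ⟨t, ht, s', he, hr⟩ := hstep P body rfl rfl _ (5 ^ n * L) n
        (Real.sqrt (accuracy n) / c) (by positivity) hσ1 (by rw [hσ]; exact ih) U
        ⟨flatten (U : Matrix (Fin d) (Fin d) ℂ) ((n + 1 : ℕ) : ℝ), fun _ => 0, h⟩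
        (readMatrix_flatten _ _) (by simp [flatten_last, hD])
      refine ⟨_, ?_, s', Exec.ifFalse ?_ he, ?_⟩
      · have h3 : T₀ + T₁ + 6 ≤ (T₀ + T₁ + 6) * 3 ^ n := Nat.le_mul_of_pos_right _ (by positivity)
        have h4 : (T₀ + T₁ + 6) * 3 ^ (n + 1) = 3 * ((T₀ + T₁ + 6) * 3 ^ n) := by ring
        simp only [RExpr.cost]
        omega
      · simp only [RExpr.eval, hD, flatten_last]
        push_cast
        have : (0 : ℝ) ≤ n := Nat.cast_nonneg n
        linarith
      · rw [hσ'] at hr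
        convert! hr using 1
        ring
  refine ⟨P, c, L + (T₀ + T₁ + 6) + T₂ + 60, hc1, fun ε N hN hN' U => ?_⟩
  obtain ⟨t₀, s₀, ht₀, hr₀, hs₀, he₀⟩ := exec_levelProc (P := P) rfl hN hN' [] N 0 (zero_add N)
  set s : State (SU d) := { reg := inputReg U ε, ptr := fun _ => 0, store := [] } with hs
  have hcall := Exec.call (P := P) (f := 0) (x := D) (m := 1) (y := 0) (l := 0)
    (args := ![.const 0, .const (1 / 4), .mul (.const (c ^ 2)) (.reg D)])
    (pargs := (Fin.elim0 : Fin 0 → ℕ)) (s := s) (t := t₀) (s' := s₀) (body := levelProc _) rfl (by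
      convert! he₀ using 2
      congr 1
      funext i
      fin_cases i
      · simp [RExpr.eval]
      · simp [RExpr.eval, accuracy]
      · simp [RExpr.eval, hs, inputReg_eq_flatten, flatten_last, hD])
  set s₁ : State (SU d) := { reg := storeResults s.reg s₀.reg D 1
                             ptr := storeResults s.ptr s₀.ptr 0 0
                             store := s₀.store } with hs₁
  have hU₁ : readMatrix d 0 s₁.reg = U := by
    rw [hs₁, readMatrix_storeResults_of_disjoint _ _ (Or.inl (by omega)), hs, inputReg_eq_flatten,
      readMatrix_flatten]
  have hN₁ : s₁.reg D = N := by simp [hs₁, storeResults, hr₀]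
  obtain ⟨t₁, ht₁, s', he₁, w, hGw, hδ, hL, -, -, hd, -⟩ := hrec N U s₁.store
  obtain ⟨t₂, ht₂, he₂⟩ := hstart P body s₁ t₁ s' rfl (by rw [hU₁, hN₁]; exact he₁)
  refine ⟨_, w, ⟨_, Exec.seq hcall he₂, ?_⟩, ⟨hGw, ?_⟩, ?_, ?_⟩
  · exact ⟨by simpa [storeResults] using hd.1, by simpa [storeResults] using hd.2⟩
  · rw [opDist_eq_norm]
    refine hδ.trans_lt ?_
    rw [div_lt_iff₀ (by positivity)]
    linarith
  · refine hL.trans ?_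
    rw [mul_comm]
    exact Nat.mul_le_mul_right _ (by omega)
  · have h3 : N + 1 ≤ 3 ^ N := Nat.lt_pow_self (by norm_num)
    have hcost : (∑ i, ((![.const 0, .const (1 / 4), .mul (.const (c ^ 2)) (.reg D)] :
        Fin 3 → RExpr) i).cost) = 5 := by
      simp [Fin.sum_univ_three, RExpr.cost]
    rw [hcost]
    have h1 : 1 ≤ 3 ^ N := Nat.one_le_pow _ _ (by norm_num)
    have h4 : T₂ ≤ T₂ * 3 ^ N := Nat.le_mul_of_pos_right _ (by positivity)
    rw [add_mul, add_mul, add_mul]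
    have h5 := Nat.zero_le (L * 3 ^ N)
    omega

end SolovayKitaev

end

theorem mainTheorem1 (d : ℕ) (G : Finset (SolovayKitaev.SU d))
    (hG : SolovayKitaev.IsInstructionSet G) :
    (∃ K : ℝ, ∀ ε : ℝ, 0 < ε → ∀ U : SolovayKitaev.SU d, ∃ w : List (SolovayKitaev.SU d),
      SolovayKitaev.IsApproximation G U ε w ∧
      (w.length : ℝ) ≤ K * (max 1 (Real.log (1 / ε))) ^ (Real.log 5 / Real.log (3 / 2))) ∧
    (∃ (P : SolovayKitaev.Program (SolovayKitaev.SU d)) (K : ℝ),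
      ∀ ε : ℝ, 0 < ε → ∀ U : SolovayKitaev.SU d,
      ∃ (t : ℕ) (w : List (SolovayKitaev.SU d)),
        P.Outputs U ε t w ∧
        SolovayKitaev.IsApproximation G U ε w ∧
        (w.length : ℝ) ≤ K * (max 1 (Real.log (1 / ε))) ^ (Real.log 5 / Real.log (3 / 2)) ∧
        (t : ℝ) ≤ K * (max 1 (Real.log (1 / ε))) ^ (Real.log 3 / Real.log (3 / 2))) := by
  obtain ⟨P, c, K, hc, h⟩ := SolovayKitaev.exists_program hG
  have key : ∀ ε : ℝ, 0 < ε → ∀ U : SolovayKitaev.SU d,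
      ∃ (t : ℕ) (w : List (SolovayKitaev.SU d)),
        P.Outputs U ε t w ∧ SolovayKitaev.IsApproximation G U ε w ∧
        (w.length : ℝ) ≤
          (K * 5) * (max 1 (Real.log (1 / ε))) ^ (Real.log 5 / Real.log (3 / 2)) ∧
        (t : ℝ) ≤ (K * 5) * (max 1 (Real.log (1 / ε))) ^ (Real.log 3 / Real.log (3 / 2)) := by
    intro ε hε U
    obtain ⟨N, hN, hN'⟩ :=
      SolovayKitaev.exists_accuracy_lt (show 0 < c ^ 2 * ε from by positivity)
    obtain ⟨t, w, hout, happ, hlen, htime⟩ := h ε N hN hN' U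
    have hL : 0 < max 1 (Real.log (1 / ε)) := lt_max_of_lt_left one_pos
    have hlevel := SolovayKitaev.pow_level_le hc hε hN'
    have h5 := SolovayKitaev.pow_le_rpow_of_level (b := 5) (by norm_num) hL hlevel
    have h3 := SolovayKitaev.pow_le_rpow_of_level (b := 3) (by norm_num) hL hlevel
    have hK : (0 : ℝ) ≤ K := Nat.cast_nonneg K
    refine ⟨t, w, hout, happ, ?_, ?_⟩
    · have : (w.length : ℝ) ≤ K * 5 ^ N := by exact_mod_cast hlen
      calc (w.length : ℝ) ≤ K * 5 ^ N := this
        _ ≤ K * (5 * _) := mul_le_mul_of_nonneg_left h5 hK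
        _ = _ := by ring
    · have : (t : ℝ) ≤ K * 3 ^ N := by exact_mod_cast htime
      have hpos := Real.rpow_nonneg hL.le (Real.log 3 / Real.log (3 / 2))
      calc (t : ℝ) ≤ K * 3 ^ N := this
        _ ≤ K * (3 * _) := mul_le_mul_of_nonneg_left h3 hK
        _ ≤ _ := by nlinarith [mul_nonneg hK hpos]
  refine ⟨⟨K * 5, fun ε hε U => ?_⟩, P, K * 5, key⟩
  obtain ⟨t, w, -, happ, hlen, -⟩ := key ε hε U
  exact ⟨w, happ, hlen⟩
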